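/- Let $N\ge 3$ be an integer, $2\le\beta<N$, and let $H:\mathbb R^{N-1}\to[0,\infty)$ be a Finsler norm: $H\in C^2(\mathbb R^{N-1}\setminus\{0\})$, $H(\lambda\xi)=|\lambda|H(\xi)$, $\gamma_1|\xi|\le H(\xi)\le\gamma_2|\xi|$ for some $0<\gamma_1\le\gamma_2$, and the unit ball $\{H\le 1\}$ is strictly convex. Let $$H^0(x)=\sup_{\xi\ne 0}\frac{\langle \xi,x\rangle}{H(\xi)},\qquad \Phi^0(x,t)=\sqrt{H^0(x)^2+t^2}\quad (x\in\mathbb R^{N-1},\ t\ge 0),$$ $$\Delta_\Phi\phi=\operatorname{div}_x\bigl(H(\nabla_x\phi)\,(\nabla H)(\nabla_x\phi)\bigr)+\frac{\partial^2\phi}{\partial t^2},\qquad K(N,\beta)=2\,\frac{\Gamma\left(\frac{N+\beta}{4}-\frac12\right)\Gamma\left(\frac{N-\beta}{4}+\frac12\right)}{\Gamma\left(\frac{N+\beta}{4}-1\right)\Gamma\left(\frac{N-\beta}{4}\right)},$$ where $H(\nabla_x\phi)(\nabla H)(\nabla_x\phi)$ is read as $0$ where $\nabla_x\phi=0$, and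 let $F(a,b,c;y)$ be the Gauss hypergeometric series. 1. For $x\neq 0$ and $t\ge 0$ put $$\phi(x,t)=\frac{1}{[\Phi^0(x,t)]^{\frac{N-2}{2}}}F\Bigl(\tfrac{N+\beta}{4}-1,\tfrac{N-\beta}{4},\tfrac12;\tfrac{t^2}{[\Phi^0(x,t)]^2}\Bigr)-t\,\frac{K(N,\beta)}{[\Phi^0(x,t)]^{\frac N2}}F\Bigl(\tfrac{N+\beta}{4}-\tfrac12,\tfrac{N-\beta}{4}+\tfrac12,\tfrac32;\tfrac{t^2}{[\Phi^0(x,t)]^2}\Bigr).$$ Then $\phi$ extends to the half-axis $\{x=0,\ t>0\}$ as a regular solution of $$\Delta_\Phi\phi+\frac{(\beta-2)^2}{4}\frac{\phi}{[\Phi^0]^2}=0\ \text{ for } t>0,\qquad \phi(x,0)=[\Phi^0(x,0)]^{-\frac N2+1}\ \text{ for } x\ne0 .$$ That is, $\phi$ is $C^1$ on $\{t\ge0\}\setminus\{(0,0)\}$, both $H(\nabla_x\phi)(\nabla H)(\nabla_x\phi)$ and $\partial_t\phi$ are $C^1$ on $\{t>0\}$, and the equation and the boundary condition hold pointwise. If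 moreover the Hessian of $H^2$ is positive definite at every $\xi\neq0$, then $\phi$ is $C^2$ on $\{x\ne0,\ t\ge0\}$. Furthermore, for every $x\neq0$, with the one-sided derivative at $t=0$, $$\frac{\partial\phi}{\partial t}(x,0)=-\frac{K(N,\beta)}{[\Phi^0(x,0)]^{\frac N2}} .$$ 2. For $k\in\mathbb R$ and $0\le y<1$ let $$w_k(y)=F\Bigl(\tfrac{N+\beta}{4}-1,\tfrac{N-\beta}{4},\tfrac12;y\Bigr)+k\sqrt y\,F\Bigl(\tfrac{N+\beta}{4}-\tfrac12,\tfrac{N-\beta}{4}+\tfrac12,\tfrac32;y\Bigr).$$ Then $\theta\mapsto w_k(\sin^2\theta)$ is bounded on $[0,\frac\pi2)$ if and only if $k=-K(N,\beta)$, and the limit $\lim_{\theta\to\pi/2^-}w_k(\sin^2\theta)$ exists in $\mathbb R$ if and only if $k=-K(N,\beta)$. -/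

import Mathlib

namespace FinslerKato

noncomputable section

/-- A Finsler norm on `ℝⁿ`: a function of class `C²` away from the origin which is absolutely
homogeneous of degree one, comparable with the Euclidean norm, and strictly convex.  As a
one-homogeneous function is linear along rays, strict convexity means, as usual, that the unit ball
is a strictly convex set. -/
structure IsFinslerNorm {n : ℕ} (H : EuclideanSpace ℝ (Fin n) → ℝ) : Prop where
  contDiffOn : ContDiffOn ℝ 2 H {0}ᶜ
  homogeneous : ∀ (c : ℝ) (ξ : EuclideanSpace ℝ (Fin n)), H (c • ξ) = |c| * H ξ
  bound : ∃ γ₁ γ₂ : ℝ, 0 < γ₁ ∧ γ₁ ≤ γ₂ ∧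
    ∀ ξ : EuclideanSpace ℝ (Fin n), γ₁ * ‖ξ‖ ≤ H ξ ∧ H ξ ≤ γ₂ * ‖ξ‖
  strictConvex : StrictConvex ℝ {ξ : EuclideanSpace ℝ (Fin n) | H ξ ≤ 1}

/-- Uniform ellipticity: the Hessian of `H²` is positive definite away from the origin. -/
def HasPosDefHessian {n : ℕ} (H : EuclideanSpace ℝ (Fin n) → ℝ) : Prop :=
  ∀ ξ : EuclideanSpace ℝ (Fin n), ξ ≠ 0 → ∀ v : EuclideanSpace ℝ (Fin n), v ≠ 0 →
    0 < iteratedFDeriv ℝ 2 (fun η => H η ^ 2) ξ ![v, v]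

/-- The dual (polar) function `H⁰(x) = sup_{ξ ≠ 0} ⟨ξ, x⟩ / H(ξ)`. -/
def polar {n : ℕ} (H : EuclideanSpace ℝ (Fin n) → ℝ) (x : EuclideanSpace ℝ (Fin n)) : ℝ :=
  ⨆ ξ : {ξ : EuclideanSpace ℝ (Fin n) // ξ ≠ 0}, inner ℝ ξ.1 x / H ξ.1

/-- `Φ⁰(x, t) = √(H⁰(x)² + t²)`. -/
def Phi0 {n : ℕ} (H : EuclideanSpace ℝ (Fin n) → ℝ) (p : EuclideanSpace ℝ (Fin n) × ℝ) : ℝ :=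
  Real.sqrt (polar H p.1 ^ 2 + p.2 ^ 2)

/-- Divergence of a vector field on `ℝⁿ`. -/
def divergence {n : ℕ} (V : EuclideanSpace ℝ (Fin n) → EuclideanSpace ℝ (Fin n))
    (x : EuclideanSpace ℝ (Fin n)) : ℝ :=
  ∑ j, fderiv ℝ V x (EuclideanSpace.single j 1) j

/-- The vector field `H(∇u) (∇H)(∇u)`.  At points where `∇u = 0` it vanishes, because `H 0 = 0`. -/
def finslerFlux {n : ℕ} (H u : EuclideanSpace ℝ (Fin n) → ℝ) (x : EuclideanSpace ℝ (Fin n)) :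
    EuclideanSpace ℝ (Fin n) :=
  H (gradient u x) • gradient H (gradient u x)

/-- The Finsler-Laplace operator `Δ_H u = div (H(∇u) (∇H)(∇u))`. -/
def finslerLaplacian {n : ℕ} (H u : EuclideanSpace ℝ (Fin n) → ℝ)
    (x : EuclideanSpace ℝ (Fin n)) : ℝ :=
  divergence (finslerFlux H u) x

/-- `Δ_Φ φ = Δ_{H,x} φ + ∂²φ/∂t²` at the point `(x, t)`. -/
def laplacianPhi {n : ℕ} (H : EuclideanSpace ℝ (Fin n) → ℝ)
    (φ : EuclideanSpace ℝ (Fin n) × ℝ → ℝ) (x : EuclideanSpace ℝ (Fin n)) (t : ℝ) : ℝ :=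
  finslerLaplacian H (fun y => φ (y, t)) x + deriv (deriv fun s => φ (x, s)) t

/-- `φ` is a regular (classical) solution of
`Δ_Φ φ + ((β - 2)² / 4) φ / (Φ⁰)² = 0` for `t > 0`, `φ(x, 0) = Φ⁰(x, 0) ^ (1 - N / 2)`:
`φ` is `C¹` up to the boundary away from the origin (where the boundary datum blows up), the vector
field `(H(∇ₓφ) (∇H)(∇ₓφ), ∂φ/∂t)` whose divergence is `Δ_Φ φ` is `C¹` in the whole open half-space,
and the equation and the boundary condition hold pointwise. -/
structure IsRegularSolution {n : ℕ} (N β : ℝ) (H : EuclideanSpace ℝ (Fin n) → ℝ)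
    (φ : EuclideanSpace ℝ (Fin n) × ℝ → ℝ) : Prop where
  contDiffOn : ContDiffOn ℝ 1 φ {p | 0 ≤ p.2 ∧ p ≠ 0}
  contDiffOn_flux_x :
    ContDiffOn ℝ 1 (fun p : EuclideanSpace ℝ (Fin n) × ℝ =>
      finslerFlux H (fun y => φ (y, p.2)) p.1) {p | 0 < p.2}
  contDiffOn_flux_t :
    ContDiffOn ℝ 1 (fun p : EuclideanSpace ℝ (Fin n) × ℝ =>
      deriv (fun s => φ (p.1, s)) p.2) {p | 0 < p.2}
  equation : ∀ (x : EuclideanSpace ℝ (Fin n)) (t : ℝ), 0 < t →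
    laplacianPhi H φ x t + (β - 2) ^ 2 / 4 * (φ (x, t) / Phi0 H (x, t) ^ 2) = 0
  boundary : ∀ x : EuclideanSpace ℝ (Fin n), x ≠ 0 →
    φ (x, 0) = Phi0 H (x, 0) ^ (-N / 2 + 1)

/-- The constant `K(N, β)`. -/
def K (N β : ℝ) : ℝ :=
  2 * (Real.Gamma ((N + β) / 4 - 1 / 2) * Real.Gamma ((N - β) / 4 + 1 / 2)) /
    (Real.Gamma ((N + β) / 4 - 1) * Real.Gamma ((N - β) / 4))

/-- The explicit formula for the extremal.  It is meaningful at the points `(x, t)` with `x ≠ 0`,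
where `t² / Φ⁰(x, t)² < 1`; the hypergeometric series diverge when the argument is `1`. -/
def extremal {n : ℕ} (N β : ℝ) (H : EuclideanSpace ℝ (Fin n) → ℝ)
    (p : EuclideanSpace ℝ (Fin n) × ℝ) : ℝ :=
  1 / Phi0 H p ^ ((N - 2) / 2) *
      ordinaryHypergeometric ((N + β) / 4 - 1) ((N - β) / 4) (1 / 2) (p.2 ^ 2 / Phi0 H p ^ 2)
    - p.2 * (K N β / Phi0 H p ^ (N / 2)) *
      ordinaryHypergeometric ((N + β) / 4 - 1 / 2) ((N - β) / 4 + 1 / 2) (3 / 2)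
        (p.2 ^ 2 / Phi0 H p ^ 2)

/-- The angular profile `w_k(y)`, `0 ≤ y < 1`, with a free constant `k`. -/
def profile (N β k y : ℝ) : ℝ :=
  ordinaryHypergeometric ((N + β) / 4 - 1) ((N - β) / 4) (1 / 2) y
    + k * Real.sqrt y *
      ordinaryHypergeometric ((N + β) / 4 - 1 / 2) ((N - β) / 4 + 1 / 2) (3 / 2) y

end

end FinslerKato

namespace FinslerKato

noncomputable section

open MeasureTheory Filter Topology Set

/-! Write `a = (N+β)/4 - 1`, `b = (N-β)/4`, so `a + b = (N-2)/2` and `(a-b)² = (β-2)²/4`. Each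
hypergeometric term in the formula blows up or may blow up on the axis, where its argument reaches
1; the point is that their combination with constant `-K` does not. It is a Stieltjes-type integral:
if `u` has the Beta`(a,b)` law and `q = 2√(u(1-u)) ∈ [0,1]`, then the angular profile is the mean of
`(1 + x q) ^ (-(a+b))`, smooth for all `x > -1`, hence through `x = 1`. Its Taylor coefficients come
from the Beta moments of `q` and satisfy a two-step recursion (`angularCoeff_add_two`). This gives
both the splitting into even and odd hypergeometric parts (`angular_eq`, with odd coefficient `-K`)
and the ODE `angular_ode`. Any other constant `k` adds a nonzero multiple of a series diverging at
1, which proves the second claim. On the Finsler side, strict convexity makes the maximizer in the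
definition of the polar unique, hence continuous, so `polar H ^ 2` is `C¹` everywhere. Duality
(`smul_gradient_polarSqGrad`) then turns the flux of any function of `(polar H x ^ 2, t)` into a
scalar multiple of `x`. That field is `C¹` even if the polar is no better than `C¹`, and its
divergence needs only Euler's identity. The PDE for `ρ ^ (-(a+b)) f(t/ρ)`, with `ρ = Phi0`, thereby
collapses to the ODE for `f`. -/

/-- The integral `∫ q ^ j (1 + x q) ^ (-p) dμ`. -/
def stieltjes {α : Type*} [MeasurableSpace α] (μ : Measure α) (q : α → ℝ) (j : ℕ) (p x : ℝ) : ℝ :=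
  ∫ u, q u ^ j * (1 + x * q u) ^ (-p) ∂μ

/-! ### Smoothness and power series of Stieltjes-type integrals. -/

section Stieltjes

variable {α : Type*} [MeasurableSpace α] {μ : Measure α} [IsProbabilityMeasure μ] {q : α → ℝ}

lemma one_add_mul_ge {x y δ : ℝ} (hy : 0 ≤ y) (hy1 : y ≤ 1) (hδ : δ ≤ 1) (hx : -1 + δ ≤ x) :
    δ ≤ 1 + x * y := by
  nlinarith

lemma norm_stieltjes_integrand_le {x y δ p : ℝ} (hy : 0 ≤ y) (hy1 : y ≤ 1) (hδ0 : 0 < δ)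
    (hδ : δ ≤ 1) (hx : -1 + δ ≤ x) (hp : 0 ≤ p) (j : ℕ) :
    ‖y ^ j * (1 + x * y) ^ (-p)‖ ≤ δ ^ (-p) := by
  have h := one_add_mul_ge hy hy1 hδ hx
  have h2 : (1 + x * y) ^ (-p) ≤ δ ^ (-p) :=
    Real.rpow_le_rpow_of_nonpos hδ0 h (by linarith)
  have h3 : 0 ≤ (1 + x * y) ^ (-p) := Real.rpow_nonneg (by linarith) _
  rw [norm_mul, Real.norm_of_nonneg h3, norm_pow, Real.norm_of_nonneg hy]
  calc y ^ j * (1 + x * y) ^ (-p) ≤ 1 * (1 + x * y) ^ (-p) := by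
        gcongr; exact pow_le_one₀ hy hy1
    _ ≤ _ := by linarith

/-- The factor 2 keeps `x` in the interior of `(-1 + δ, ∞)`, where the integrands are uniformly
bounded. -/
lemma exists_pos_margin {x : ℝ} (hx : -1 < x) : ∃ δ : ℝ, 0 < δ ∧ δ ≤ 1 ∧ -1 + 2 * δ ≤ x :=
  ⟨min 1 ((1 + x) / 2), lt_min one_pos (by linarith), min_le_left _ _, by
    have := min_le_right 1 ((1 + x) / 2); linarith⟩

omit [IsProbabilityMeasure μ] in
lemma stieltjes_aestronglyMeasurable (hq : Measurable q) (j : ℕ) (p x : ℝ) :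
    AEStronglyMeasurable (fun u => q u ^ j * (1 + x * q u) ^ (-p)) μ := by
  apply Measurable.aestronglyMeasurable
  fun_prop

lemma stieltjes_integrable (hq : Measurable q) (h0 : ∀ u, 0 ≤ q u) (h1 : ∀ u, q u ≤ 1) (j : ℕ)
    {p x : ℝ} (hp : 0 ≤ p) (hx : -1 < x) :
    Integrable (fun u => q u ^ j * (1 + x * q u) ^ (-p)) μ := by
  obtain ⟨δ, hδ0, hδ1, hδx⟩ := exists_pos_margin hx
  exact Integrable.of_bound (stieltjes_aestronglyMeasurable hq j p x) (δ ^ (-p))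
    (Eventually.of_forall fun u => norm_stieltjes_integrand_le (h0 u) (h1 u) hδ0 hδ1
      (by linarith) hp j)

/-- Differentiation under the integral: since `0 ≤ q ≤ 1`, the base `1 + x q` stays above `δ` on
`(-1 + δ, ∞)`, giving a constant dominating function. -/
lemma hasDerivAt_stieltjes (hq : Measurable q) (h0 : ∀ u, 0 ≤ q u) (h1 : ∀ u, q u ≤ 1) (j : ℕ)
    {p x : ℝ} (hp : 0 ≤ p) (hx : -1 < x) :
    HasDerivAt (stieltjes μ q j p) (-p * stieltjes μ q (j + 1) (p + 1) x) x := by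
  obtain ⟨δ, hδ0, hδ1, hδx⟩ := exists_pos_margin hx
  have key := hasDerivAt_integral_of_dominated_loc_of_deriv_le (μ := μ)
    (F := fun x u => q u ^ j * (1 + x * q u) ^ (-p)) (x₀ := x)
    (F' := fun x u => -p * (q u ^ (j + 1) * (1 + x * q u) ^ (-(p + 1))))
    (bound := fun _ => p * δ ^ (-(p + 1))) (s := Ioi (-1 + δ))
    (Ioi_mem_nhds (by linarith))
    (Eventually.of_forall fun y => stieltjes_aestronglyMeasurable hq j p y)
    (stieltjes_integrable hq h0 h1 j hp hx)
    ((stieltjes_aestronglyMeasurable hq (j + 1) (p + 1) x).const_mul _)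
    (Eventually.of_forall fun u y hy => ?_) (integrable_const _)
    (Eventually.of_forall fun u y hy => ?_)
  · have := key.2
    rwa [integral_const_mul] at this
  · rw [norm_mul, norm_neg, Real.norm_of_nonneg hp]
    gcongr
    exact norm_stieltjes_integrand_le (h0 u) (h1 u) hδ0 hδ1 (le_of_lt hy) (by linarith) _
  · have hpos : 0 < 1 + y * q u := lt_of_lt_of_le hδ0
      (one_add_mul_ge (h0 u) (h1 u) hδ1 (le_of_lt hy))
    have h := ((((hasDerivAt_id y).mul_const (q u)).const_add 1).rpow_const (p := -p)
      (Or.inl hpos.ne')).const_mul (q u ^ j)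
    convert! h using 1
    rw [show -(p + 1) = -p - 1 by ring]
    simp only [id]
    ring

/-- The derivative is an integral of the same family with `j` and `p` raised by one, so the
induction must run over all `j` and `p`. -/
lemma contDiffOn_stieltjes (hq : Measurable q) (h0 : ∀ u, 0 ≤ q u) (h1 : ∀ u, q u ≤ 1) (n : ℕ) :
    ∀ (j : ℕ) {p : ℝ}, 0 ≤ p → ContDiffOn ℝ n (stieltjes μ q j p) (Ioi (-1)) := by
  induction n with
  | zero =>
    intro j p hp
    exact contDiffOn_zero.2 fun x hx =>
      (hasDerivAt_stieltjes hq h0 h1 j hp hx).continuousAt.continuousWithinAt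
  | succ n ih =>
    intro j p hp
    push_cast
    rw [contDiffOn_succ_iff_deriv_of_isOpen isOpen_Ioi]
    refine ⟨fun x hx => (hasDerivAt_stieltjes hq h0 h1 j hp hx).differentiableAt.differentiableWithinAt,
      by simp, ?_⟩
    refine ((contDiffOn_const (c := -p)).mul (ih (j + 1) (p := p + 1) (by linarith))).congr fun x hx => ?_
    exact (hasDerivAt_stieltjes hq h0 h1 j hp hx).deriv

/-- Coefficients of the expansion of `(1 + x) ^ (-p)`. -/
def binomCoeff (p : ℝ) (k : ℕ) : ℝ := Ring.choose (-p) k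

lemma binomCoeff_zero (p : ℝ) : binomCoeff p 0 = 1 := by simp [binomCoeff]

lemma binomCoeff_succ (p : ℝ) (k : ℕ) :
    (k + 1) * binomCoeff p (k + 1) = -(p + k) * binomCoeff p k := by
  have := Ring.descPochhammer_eq_factorial_smul_choose (-p) k
  have h2 := Ring.descPochhammer_eq_factorial_smul_choose (-p) (k + 1)
  rw [descPochhammer_succ_right, Polynomial.smeval_mul, this] at h2
  simp [Polynomial.smeval_sub, Polynomial.smeval_natCast, Nat.factorial_succ] at h2
  have hk : (k.factorial : ℝ) ≠ 0 := by positivity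
  unfold binomCoeff
  apply mul_left_cancel₀ hk
  linear_combination -h2

/-- Compares the expansion of a differentiated integral with the termwise derivative of the original
series. -/
lemma binomCoeff_add_one (p : ℝ) (k : ℕ) :
    -p * binomCoeff (p + 1) k = (k + 1) * binomCoeff p (k + 1) := by
  induction k with
  | zero => have := binomCoeff_succ p 0; simp [binomCoeff_zero] at this ⊢; linarith
  | succ k ih =>
    have h1 := binomCoeff_succ (p + 1) k
    have h2 := binomCoeff_succ p (k + 1)
    push_cast at *
    have : ((k : ℝ) + 1) ≠ 0 := by positivity
    apply mul_left_cancel₀ this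
    linear_combination (-p) * h1 - (p + 1 + k) * ih - (k + 1) * h2

lemma hasSum_binomCoeff {p x : ℝ} (hx : |x| < 1) :
    HasSum (fun k => binomCoeff p k * x ^ k) ((1 + x) ^ (-p)) := by
  have h := (Real.one_add_rpow_hasFPowerSeriesOnBall_zero (a := -p)).hasSum (y := x)
    (by simpa [← ENNReal.ofReal_one, Metric.eball_ofReal] using hx)
  simpa [binomCoeff, -FormalMultilinearSeries.apply_eq_prod_smul_coeff] using h

lemma summable_abs_binomCoeff {p x : ℝ} (hx : |x| < 1) :
    Summable (fun k => |binomCoeff p k| * |x| ^ k) := by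
  have := (hasSum_binomCoeff (p := p) (x := |x|) (by simpa using hx)).summable.abs
  simpa [abs_mul] using this

lemma hasSum_stieltjes (hq : Measurable q) (h0 : ∀ u, 0 ≤ q u) (h1 : ∀ u, q u ≤ 1) (j : ℕ)
    {p x : ℝ} (hx : |x| < 1) :
    HasSum (fun k => binomCoeff p k * (∫ u, q u ^ (j + k) ∂μ) * x ^ k) (stieltjes μ q j p x) := by
  have hint : ∀ k, Integrable (fun u => q u ^ k) μ := fun k =>
    Integrable.of_bound (by apply Measurable.aestronglyMeasurable; fun_prop) 1
      (Eventually.of_forall fun u => by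
        rw [norm_pow, Real.norm_of_nonneg (h0 u)]; exact pow_le_one₀ (h0 u) (h1 u))
  have h := hasSum_integral_of_summable_integral_norm (μ := μ)
    (F := fun k u => (binomCoeff p k * x ^ k) * q u ^ (j + k))
    (fun k => (hint _).const_mul _) ?_
  · convert! h using 1
    · ext k; rw [integral_const_mul]; ring
    · unfold stieltjes
      congr 1; ext u
      have hs : |x * q u| < 1 := by
        rw [abs_mul, abs_of_nonneg (h0 u)]
        nlinarith [h0 u, h1 u, abs_nonneg x]
      rw [← (hasSum_binomCoeff (p := p) hs).tsum_eq, ← tsum_mul_left]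
      congr 1; ext k; rw [mul_pow, pow_add]; ring
  · refine Summable.of_nonneg_of_le (fun k => by positivity) (fun k => ?_)
      (summable_abs_binomCoeff (p := p) hx)
    calc ∫ u, ‖binomCoeff p k * x ^ k * q u ^ (j + k)‖ ∂μ
        ≤ ∫ u, |binomCoeff p k| * |x| ^ k ∂μ := by
          apply integral_mono ((hint _).const_mul _).norm (integrable_const _)
          intro u
          simp only [norm_mul, norm_pow, Real.norm_eq_abs, abs_of_nonneg (h0 u)]
          exact mul_le_of_le_one_right (by positivity) (pow_le_one₀ (h0 u) (h1 u))
      _ = _ := by simp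

end Stieltjes

/-! ### The angular profile as a Beta average, its Taylor coefficients and its ODE. -/

section Beta

open ProbabilityTheory

/-- The weight `2√(u(1 - u))`, with values in `[0, 1]`. -/
def betaWeight (u : ℝ) : ℝ := 2 * √(u * (1 - u))

lemma measurable_betaWeight : Measurable betaWeight := by
  unfold betaWeight; fun_prop

lemma betaWeight_nonneg (u : ℝ) : 0 ≤ betaWeight u := by unfold betaWeight; positivity

lemma betaWeight_le_one (u : ℝ) : betaWeight u ≤ 1 := by
  have : √(u * (1 - u)) ≤ 1 / 2 :=
    (Real.sqrt_le_left (by norm_num)).2 (by nlinarith [sq_nonneg (u - 1 / 2)])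
  unfold betaWeight; linarith

lemma integral_betaMeasure {a b : ℝ} (ha : 0 < a) (hb : 0 < b) (f : ℝ → ℝ) :
    ∫ u, f u ∂(betaMeasure a b) = ∫ u, betaPDFReal a b u * f u := by
  have hnn : ∀ u, 0 ≤ betaPDFReal a b u := fun u => by
    by_cases h : 0 < u ∧ u < 1
    · exact (betaPDFReal_pos h.1 h.2 ha hb).le
    · rw [betaPDFReal, if_neg h]
  rw [betaMeasure, integral_withDensity_eq_integral_toReal_smul]
  · congr 1; ext u
    simp [betaPDF, ENNReal.toReal_ofReal (hnn u)]
  · exact (measurable_betaPDFReal a b).ennreal_ofReal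
  · exact Eventually.of_forall fun u => by simp [betaPDF]

/-- Multiplying the Beta`(a,b)` density by `(u(1-u)) ^ (k/2)` gives, up to normalization, the
density with both parameters raised by `k/2`. -/
lemma integral_betaWeight_pow {a b : ℝ} (ha : 0 < a) (hb : 0 < b) (k : ℕ) :
    ∫ u, betaWeight u ^ k ∂(betaMeasure a b) =
      2 ^ k * beta (a + k / 2) (b + k / 2) / beta a b := by
  have ha' : 0 < a + k / 2 := by positivity
  have hb' : 0 < b + k / 2 := by positivity
  have h1 : ∫ u, betaPDFReal (a + k / 2) (b + k / 2) u = 1 := by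
    have := isProbabilityMeasureBeta ha' hb'
    have h := integral_betaMeasure ha' hb' (fun _ => 1)
    simpa using h.symm
  rw [integral_betaMeasure ha hb]
  have h2 : ∀ u, betaPDFReal a b u * betaWeight u ^ k =
      (2 ^ k * beta (a + k / 2) (b + k / 2) / beta a b) *
        betaPDFReal (a + k / 2) (b + k / 2) u := by
    intro u
    unfold betaPDFReal
    split_ifs with h
    · have hB := (beta_pos ha hb).ne'
      have hB' := (beta_pos ha' hb').ne'
      have hu := h.1
      have hu' : 0 < 1 - u := by linarith [h.2]
      have e1 : betaWeight u ^ k = 2 ^ k * (u ^ ((k : ℝ) / 2) * (1 - u) ^ ((k : ℝ) / 2)) := by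
        rw [betaWeight, mul_pow, Real.sqrt_eq_rpow, ← Real.rpow_mul_natCast (by positivity),
          Real.mul_rpow hu.le hu'.le]
        congr 3 <;> ring
      rw [e1, show a + k / 2 - 1 = (a - 1) + k / 2 by ring,
        show b + k / 2 - 1 = (b - 1) + k / 2 by ring, Real.rpow_add hu, Real.rpow_add hu']
      generalize beta (a + k / 2) (b + k / 2) = B at hB'
      field_simp
    · simp
  simp_rw [h2]
  rw [integral_const_mul, h1, mul_one]

/-- The normalized angular profile. -/
def angular (a b : ℝ) (x : ℝ) : ℝ := stieltjes (betaMeasure a b) betaWeight 0 (a + b) x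

/-- Its Taylor coefficients at `0`. -/
def angularCoeff (a b : ℝ) (k : ℕ) : ℝ :=
  binomCoeff (a + b) k * ∫ u, betaWeight u ^ k ∂(betaMeasure a b)

lemma beta_add_one {a b : ℝ} (ha : 0 < a) (hb : 0 < b) :
    beta (a + 1) (b + 1) = a * b / ((a + b) * (a + b + 1)) * beta a b := by
  have : 0 < Real.Gamma (a + b) := Real.Gamma_pos_of_pos (by positivity)
  unfold beta
  rw [Real.Gamma_add_one ha.ne', Real.Gamma_add_one hb.ne',
    show a + 1 + (b + 1) = (a + b + 1) + 1 by ring, Real.Gamma_add_one (by positivity),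
    Real.Gamma_add_one (by positivity)]
  field_simp

variable {a b : ℝ}

lemma angularCoeff_zero (ha : 0 < a) (hb : 0 < b) : angularCoeff a b 0 = 1 := by
  have := isProbabilityMeasureBeta ha hb
  simp [angularCoeff, binomCoeff_zero]

lemma angularCoeff_one (ha : 0 < a) (hb : 0 < b) : angularCoeff a b 1 =
    -(2 * (Real.Gamma (a + 1 / 2) * Real.Gamma (b + 1 / 2)) /
      (Real.Gamma a * Real.Gamma b)) := by
  have h := binomCoeff_succ (a + b) 0
  have : 0 < Real.Gamma (a + b) := Real.Gamma_pos_of_pos (by positivity)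
  have : 0 < Real.Gamma a := Real.Gamma_pos_of_pos (by positivity)
  have : 0 < Real.Gamma b := Real.Gamma_pos_of_pos (by positivity)
  simp only [binomCoeff_zero] at h
  norm_num at h
  rw [angularCoeff, integral_betaWeight_pow ha hb, h, beta, beta]
  simp only [Nat.cast_one]
  rw [show a + 1 / 2 + (b + 1 / 2) = a + b + 1 by ring, Real.Gamma_add_one (by positivity)]
  field_simp
  ring

/-- Raising `k` by two shifts both Beta parameters by one. The denominator `(a+b+k)(a+b+k+1)` this
produces is cancelled by two steps of the binomial recursion. -/
lemma angularCoeff_add_two (ha : 0 < a) (hb : 0 < b) (k : ℕ) :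
    (k + 1) * (k + 2) * angularCoeff a b (k + 2) =
      (2 * a + k) * (2 * b + k) * angularCoeff a b k := by
  have h1 := binomCoeff_succ (a + b) k
  have h2 := binomCoeff_succ (a + b) (k + 1)
  have hb0 := (beta_pos ha hb).ne'
  have ha' : 0 < a + k / 2 := by positivity
  have hb' : 0 < b + k / 2 := by positivity
  have h3 := beta_add_one ha' hb'
  rw [angularCoeff, angularCoeff, integral_betaWeight_pow ha hb, integral_betaWeight_pow ha hb]
  push_cast at *
  rw [show a + (k + 2) / 2 = a + k / 2 + 1 by ring, show b + ((k : ℝ) + 2) / 2 = b + k / 2 + 1 by ring,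
    h3]
  have h4 : ((k : ℝ) + 1) * (k + 2) * binomCoeff (a + b) (k + 2) =
      (a + b + (k + 1)) * (a + b + k) * binomCoeff (a + b) k := by
    rw [show (k : ℝ) + 1 + 1 = k + 2 by ring] at h2
    linear_combination (k + 1) * h2 - (a + b + (k + 1)) * h1
  have e1 : a + k / 2 + (b + k / 2) = a + b + k := by ring
  have e2 : (a + k / 2) * (b + k / 2) = (2 * a + k) * (2 * b + k) / 4 := by ring
  rw [e1, e2, ← mul_assoc, h4]
  have : 0 < a + b + k := by positivity
  field_simp
  ring

lemma hasSum_angular (ha : 0 < a) (hb : 0 < b) {x : ℝ} (hx : |x| < 1) :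
    HasSum (fun k => angularCoeff a b k * x ^ k) (angular a b x) := by
  have := isProbabilityMeasureBeta ha hb
  simpa [angularCoeff, angular] using hasSum_stieltjes (μ := betaMeasure a b) measurable_betaWeight
    betaWeight_nonneg betaWeight_le_one 0 (p := a + b) hx

/-- First derivative of `angular`. -/
def angularDeriv (a b : ℝ) (x : ℝ) : ℝ :=
  -(a + b) * stieltjes (betaMeasure a b) betaWeight 1 (a + b + 1) x

/-- Second derivative of `angular`. -/
def angularDerivTwo (a b : ℝ) (x : ℝ) : ℝ :=
  -(a + b) * (-(a + b + 1) * stieltjes (betaMeasure a b) betaWeight 2 (a + b + 1 + 1) x)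

lemma hasDerivAt_angular (ha : 0 < a) (hb : 0 < b) {x : ℝ} (hx : -1 < x) :
    HasDerivAt (angular a b) (angularDeriv a b x) x := by
  have := isProbabilityMeasureBeta ha hb
  exact hasDerivAt_stieltjes (μ := betaMeasure a b) measurable_betaWeight
    betaWeight_nonneg betaWeight_le_one 0 (p := a + b) (by positivity) hx

lemma hasDerivAt_angularDeriv (ha : 0 < a) (hb : 0 < b) {x : ℝ} (hx : -1 < x) :
    HasDerivAt (angularDeriv a b) (angularDerivTwo a b x) x := by
  have := isProbabilityMeasureBeta ha hb
  exact (hasDerivAt_stieltjes (μ := betaMeasure a b) measurable_betaWeight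
    betaWeight_nonneg betaWeight_le_one 1 (p := a + b + 1) (by positivity) hx).const_mul _

lemma contDiffOn_angular (ha : 0 < a) (hb : 0 < b) (n : ℕ) :
    ContDiffOn ℝ n (angular a b) (Ioi (-1)) := by
  have := isProbabilityMeasureBeta ha hb
  exact contDiffOn_stieltjes measurable_betaWeight betaWeight_nonneg betaWeight_le_one n 0
    (by positivity)

lemma contDiffOn_angularDeriv (ha : 0 < a) (hb : 0 < b) (n : ℕ) :
    ContDiffOn ℝ n (angularDeriv a b) (Ioi (-1)) := by
  have := isProbabilityMeasureBeta ha hb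
  exact contDiffOn_const.mul (contDiffOn_stieltjes measurable_betaWeight betaWeight_nonneg
    betaWeight_le_one n 1 (by positivity))

lemma continuousAt_angularDerivTwo (ha : 0 < a) (hb : 0 < b) {x : ℝ} (hx : -1 < x) :
    ContinuousAt (angularDerivTwo a b) x := by
  have := isProbabilityMeasureBeta ha hb
  exact ((hasDerivAt_stieltjes (μ := betaMeasure a b) measurable_betaWeight
    betaWeight_nonneg betaWeight_le_one 2 (p := a + b + 1 + 1) (by positivity)
    hx).continuousAt.const_mul _).const_mul _

lemma hasSum_angularDeriv (ha : 0 < a) (hb : 0 < b) {x : ℝ} (hx : |x| < 1) :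
    HasSum (fun k : ℕ => (k + 1) * angularCoeff a b (k + 1) * x ^ k) (angularDeriv a b x) := by
  have := isProbabilityMeasureBeta ha hb
  have h := (hasSum_stieltjes (μ := betaMeasure a b) measurable_betaWeight
    betaWeight_nonneg betaWeight_le_one 1 (p := a + b + 1) hx).mul_left (-(a + b))
  convert! h using 1
  ext k
  have := binomCoeff_add_one (a + b) k
  rw [angularCoeff, add_comm 1 k]
  linear_combination -(∫ u, betaWeight u ^ (k + 1) ∂(betaMeasure a b)) * x ^ k * this

lemma hasSum_angularDerivTwo (ha : 0 < a) (hb : 0 < b) {x : ℝ} (hx : |x| < 1) :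
    HasSum (fun k : ℕ => (k + 1) * (k + 2) * angularCoeff a b (k + 2) * x ^ k)
      (angularDerivTwo a b x) := by
  have := isProbabilityMeasureBeta ha hb
  have h := ((hasSum_stieltjes (μ := betaMeasure a b) measurable_betaWeight
    betaWeight_nonneg betaWeight_le_one 2 (p := a + b + 1 + 1) hx).mul_left
      (-(a + b + 1))).mul_left (-(a + b))
  convert! h using 1
  ext k
  have h1 := binomCoeff_add_one (a + b + 1) k
  have h2 := binomCoeff_add_one (a + b) (k + 1)
  push_cast at h2
  rw [angularCoeff, add_comm 2 k]
  linear_combination (∫ u, betaWeight u ^ (k + 2) ∂(betaMeasure a b)) * x ^ k *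
    ((a + b) * h1 - (k + 1) * h2)

/-- Multiplication by `x` as a shift of coefficients, used to build the series of `x f'` and `x²
f''`. -/
lemma hasSum_mul_succ {c : ℕ → ℝ} {x s : ℝ} (h : HasSum (fun k : ℕ => c k * x ^ k) s)
    (d : ℕ → ℝ) (hd0 : d 0 = 0) (hd : ∀ k, d (k + 1) = c k) :
    HasSum (fun k : ℕ => d k * x ^ k) (x * s) := by
  rw [← hasSum_nat_add_iff' 1]
  simp only [Finset.range_one, Finset.sum_singleton, hd0, zero_mul, sub_zero, hd]
  convert! h.mul_left x using 1
  ext k; ring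

lemma angular_ode_of_abs_lt (ha : 0 < a) (hb : 0 < b) {x : ℝ} (hx : |x| < 1) :
    (1 - x ^ 2) * angularDerivTwo a b x - (2 * (a + b) + 1) * x * angularDeriv a b x
      - 4 * a * b * angular a b x = 0 := by
  have s0 := hasSum_angular ha hb hx
  have s1 := hasSum_mul_succ (hasSum_angularDeriv ha hb hx) (fun k => k * angularCoeff a b k)
    (by simp) (by simp)
  have s2 := hasSum_angularDerivTwo ha hb hx
  -- Two shifts give `x² f''` the coefficients `(k-1) k c_k`, whose `k = 0, 1` entries vanish.
  have s3 := hasSum_mul_succ (hasSum_mul_succ s2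
    (fun k => k * (k + 1) * angularCoeff a b (k + 1)) (by simp) (by intro k; push_cast; ring))
    (fun k => (k - 1) * k * angularCoeff a b k) (by simp) (by intro k; push_cast; ring)
  have h := ((s2.sub s3).sub (s1.mul_left (2 * (a + b) + 1))).sub (s0.mul_left (4 * a * b))
  have h0 : HasSum (fun _ : ℕ => (0 : ℝ)) 0 := hasSum_zero
  have := h.unique (h0.congr_fun ?_)
  · linear_combination this
  · intro k
    have := angularCoeff_add_two ha hb k
    linear_combination x ^ k * this

/-- The endpoint `x = 1` is the half-axis of the half-space. It lies outside the open disc of the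
series and is reached by continuity of both derivatives. -/
lemma angular_ode (ha : 0 < a) (hb : 0 < b) {x : ℝ} (hx0 : -1 < x) (hx : x ≤ 1) :
    (1 - x ^ 2) * angularDerivTwo a b x - (2 * (a + b) + 1) * x * angularDeriv a b x
      - 4 * a * b * angular a b x = 0 := by
  rcases hx.lt_or_eq with h | rfl
  · exact angular_ode_of_abs_lt ha hb (abs_lt.2 ⟨hx0, h⟩)
  · set f := fun x => (1 - x ^ 2) * angularDerivTwo a b x -
      (2 * (a + b) + 1) * x * angularDeriv a b x - 4 * a * b * angular a b x
    have hc : ContinuousAt f 1 := by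
      have c0 := (hasDerivAt_angular ha hb hx0).continuousAt
      have c1 := (hasDerivAt_angularDeriv ha hb hx0).continuousAt
      have c2 := continuousAt_angularDerivTwo ha hb hx0
      fun_prop
    refine tendsto_nhds_unique (hc.tendsto.mono_left (nhdsWithin_le_nhds (s := Iio 1))) ?_
    refine tendsto_const_nhds.congr' ?_
    filter_upwards [Ioo_mem_nhdsLT (show (0 : ℝ) < 1 by norm_num)] with y hy
    exact (angular_ode_of_abs_lt ha hb (abs_lt.2 ⟨by linarith [hy.1], hy.2⟩)).symm

end Beta

/-! ### Hypergeometric series: divergence at 1 and the even/odd splitting. -/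

section Hypergeometric

lemma hypCoeff_succ {a b c : ℝ} (hc : 0 < c) (n : ℕ) :
    (n + 1) * (c + n) * ordinaryHypergeometricCoefficient a b c (n + 1) =
      (a + n) * (b + n) * ordinaryHypergeometricCoefficient a b c n := by
  have h1 : (ascPochhammer ℝ n).eval c ≠ 0 := (ascPochhammer_pos n c hc).ne'
  have h2 : c + n ≠ 0 := by positivity
  simp only [ordinaryHypergeometricCoefficient, ascPochhammer_succ_eval, Nat.factorial_succ]
  push_cast
  field_simp

lemma hypCoeff_zero (a b c : ℝ) : ordinaryHypergeometricCoefficient a b c 0 = 1 := by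
  simp [ordinaryHypergeometricCoefficient]

lemma hypCoeff_pos {a b c : ℝ} (ha : 0 < a) (hb : 0 < b) (hc : 0 < c) (n : ℕ) :
    0 < ordinaryHypergeometricCoefficient a b c n := by
  have h1 := ascPochhammer_pos n c hc
  have h2 := ascPochhammer_pos n a ha
  have h3 := ascPochhammer_pos n b hb
  unfold ordinaryHypergeometricCoefficient
  positivity

lemma hasSum_ordinaryHypergeometric {a b c y : ℝ} (ha : 0 < a) (hb : 0 < b) (hc : 0 < c)
    (hy : |y| < 1) :
    HasSum (fun n => ordinaryHypergeometricCoefficient a b c n * y ^ n)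
      (ordinaryHypergeometric a b c y) := by
  have hr := ordinaryHypergeometricSeries_radius_eq_one ℝ a b c (fun k => by
    have : (0 : ℝ) ≤ k := k.cast_nonneg
    refine ⟨?_, ?_, ?_⟩ <;> linarith)
  have hs := (ordinaryHypergeometricSeries ℝ a b c).hasSum (x := y)
    (by rw [hr]; simpa [← ENNReal.ofReal_one, Metric.eball_ofReal] using hy)
  convert! hs using 1
  ext n
  rw [ordinaryHypergeometricSeries_apply_eq, smul_eq_mul]

/-- When `c ≤ a + b`, the sequence `n t_n` is nondecreasing for `n ≥ 1`, so the positive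
coefficients dominate a harmonic series. -/
lemma tendsto_ordinaryHypergeometric_atTop {a b c : ℝ} (ha : 0 < a) (hb : 0 < b) (hc : 0 < c)
    (hab : c ≤ a + b) : Tendsto (ordinaryHypergeometric a b c : ℝ → ℝ) (𝓝[<] 1) atTop := by
  set t := ordinaryHypergeometricCoefficient a b c with ht
  have hpos : ∀ n, 0 < t n := hypCoeff_pos ha hb hc
  have hmono : ∀ n : ℕ, t 1 ≤ (n + 1) * t (n + 1) := by
    intro n
    induction n with
    | zero => simp
    | succ n ih =>
      refine ih.trans ?_
      have h := hypCoeff_succ (a := a) (b := b) hc (n + 1)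
      push_cast at *
      have hp := hpos (n + 1)
      have h2 : 0 < c + ((n : ℝ) + 1) := by positivity
      have h3 : ((n : ℝ) + 1) * (c + (n + 1)) ≤ (a + (n + 1)) * (b + (n + 1)) := by
        nlinarith [mul_pos ha hb]
      refine le_of_mul_le_mul_left ?_ h2
      nlinarith [mul_le_mul_of_nonneg_right h3 hp.le]
  have hns : ¬ Summable t := by
    intro hs
    have h1 : Summable fun n : ℕ => t 1 * (1 / ((n + 1 : ℕ) : ℝ)) := by
      refine Summable.of_nonneg_of_le (fun n => ?_) (fun n => ?_) ((summable_nat_add_iff 1).2 hs)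
      · have := hpos 1; positivity
      · have := hmono n
        push_cast
        rw [mul_one_div, div_le_iff₀ (by positivity)]
        linarith
    rw [summable_mul_left_iff (hpos 1).ne', summable_nat_add_iff 1 (f := fun n : ℕ => 1 / (n : ℝ))]
      at h1
    exact Real.not_summable_one_div_natCast h1
  have htop := (not_summable_iff_tendsto_nat_atTop_of_nonneg (fun n => (hpos n).le)).1 hns
  rw [tendsto_atTop]
  intro M
  -- A partial sum above `M + 1` at `y = 1` stays above `M` for `y` near 1, and the remaining terms
  -- are nonnegative.
  obtain ⟨n, hn⟩ := ((tendsto_atTop.1 htop) (M + 1)).exists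
  have hcont : Tendsto (fun y : ℝ => ∑ k ∈ Finset.range n, t k * y ^ k) (𝓝[<] 1)
      (𝓝 (∑ k ∈ Finset.range n, t k * 1 ^ k)) :=
    (Continuous.tendsto (by fun_prop) 1).mono_left nhdsWithin_le_nhds
  simp only [one_pow, mul_one] at hcont
  filter_upwards [hcont.eventually (lt_mem_nhds (show M < _ by linarith)),
    Ioo_mem_nhdsLT (show (0 : ℝ) < 1 by norm_num)] with y hy hy1
  have hs := hasSum_ordinaryHypergeometric ha hb hc (y := y)
    (abs_lt.2 ⟨by linarith [hy1.1], hy1.2⟩)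
  refine hy.le.trans (sum_le_hasSum _ (fun k _ => ?_) hs)
  exact mul_nonneg (hpos k).le (pow_nonneg hy1.1.le _)

variable {a b : ℝ}

lemma angularCoeff_even (ha : 0 < a) (hb : 0 < b) (n : ℕ) :
    angularCoeff a b (2 * n) = ordinaryHypergeometricCoefficient a b (1 / 2) n := by
  induction n with
  | zero => rw [mul_zero, angularCoeff_zero ha hb, hypCoeff_zero]
  | succ n ih =>
    have h1 := angularCoeff_add_two ha hb (2 * n)
    have h2 := hypCoeff_succ (a := a) (b := b) (c := 1 / 2) (by norm_num) n
    rw [ih] at h1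
    push_cast at h1
    have : ((n : ℝ) + 1) * (1 / 2 + n) ≠ 0 := by positivity
    apply mul_left_cancel₀ this
    rw [h2, show 2 * (n + 1) = 2 * n + 2 by ring]
    linear_combination h1 / 4

lemma angularCoeff_odd (ha : 0 < a) (hb : 0 < b) (n : ℕ) :
    angularCoeff a b (2 * n + 1) = angularCoeff a b 1 *
      ordinaryHypergeometricCoefficient (a + 1 / 2) (b + 1 / 2) (3 / 2) n := by
  induction n with
  | zero => rw [hypCoeff_zero, mul_one, mul_zero, zero_add]
  | succ n ih =>
    have h1 := angularCoeff_add_two ha hb (2 * n + 1)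
    have h2 := hypCoeff_succ (a := a + 1 / 2) (b := b + 1 / 2) (c := 3 / 2) (by norm_num) n
    rw [ih] at h1
    push_cast at h1
    have : ((n : ℝ) + 1) * (3 / 2 + n) ≠ 0 := by positivity
    apply mul_left_cancel₀ this
    rw [show 2 * (n + 1) + 1 = 2 * n + 1 + 2 by ring]
    linear_combination h1 / 4 - angularCoeff a b 1 * h2

/-- The two-step recursion decouples even and odd coefficients, and each half is the recursion of a
hypergeometric series in `x²`. -/
lemma angular_eq (ha : 0 < a) (hb : 0 < b) {x : ℝ} (hx : |x| < 1) :
    angular a b x = ordinaryHypergeometric a b (1 / 2) (x ^ 2) + angularCoeff a b 1 * x *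
      ordinaryHypergeometric (a + 1 / 2) (b + 1 / 2) (3 / 2) (x ^ 2) := by
  have hx2 : |x ^ 2| < 1 := by
    rw [abs_pow]; exact pow_lt_one₀ (abs_nonneg x) hx two_ne_zero
  have s1 := hasSum_ordinaryHypergeometric ha hb (c := 1 / 2) (by norm_num) hx2
  have s2 := (hasSum_ordinaryHypergeometric (a := a + 1 / 2) (b := b + 1 / 2) (by positivity)
    (by positivity) (c := 3 / 2) (by norm_num) hx2).mul_left (angularCoeff a b 1 * x)
  have s0 := hasSum_angular ha hb hx
  refine s0.unique (HasSum.even_add_odd ?_ ?_)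
  · convert! s1 using 1
    ext n
    rw [angularCoeff_even ha hb, pow_mul]
  · convert! s2 using 1
    ext n
    rw [angularCoeff_odd ha hb, pow_succ, pow_mul]
    ring

lemma angular_zero (ha : 0 < a) (hb : 0 < b) : angular a b 0 = 1 := by
  rw [angular_eq ha hb (by simp)]; simp

lemma angularDeriv_zero (ha : 0 < a) (hb : 0 < b) : angularDeriv a b 0 = angularCoeff a b 1 := by
  have h := (hasSum_angularDeriv ha hb (x := 0) (by simp)).unique
    (hasSum_single 0 (fun k hk => by simp [hk]))
  simpa using h

end Hypergeometric

/-! ### Boundedness and limit of the angular profile at `π / 2`. -/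

section Profile

variable {N β : ℝ}

lemma angularCoeff_one_eq_neg_K (ha : 0 < (N + β) / 4 - 1) (hb : 0 < (N - β) / 4) :
    angularCoeff ((N + β) / 4 - 1) ((N - β) / 4) 1 = -K N β := by
  rw [angularCoeff_one ha hb, K, show (N + β) / 4 - 1 + 1 / 2 = (N + β) / 4 - 1 / 2 by ring]

lemma angular_eq_profile (ha : 0 < (N + β) / 4 - 1) (hb : 0 < (N - β) / 4) {x : ℝ}
    (hx : |x| < 1) :
    angular ((N + β) / 4 - 1) ((N - β) / 4) x =
      ordinaryHypergeometric ((N + β) / 4 - 1) ((N - β) / 4) (1 / 2) (x ^ 2) - K N β * x *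
        ordinaryHypergeometric ((N + β) / 4 - 1 / 2) ((N - β) / 4 + 1 / 2) (3 / 2) (x ^ 2) := by
  rw [angular_eq ha hb hx, angularCoeff_one_eq_neg_K ha hb,
    show (N + β) / 4 - 1 + 1 / 2 = (N + β) / 4 - 1 / 2 by ring]
  ring

lemma sin_mem_Ico {θ : ℝ} (hθ : θ ∈ Ico 0 (Real.pi / 2)) : Real.sin θ ∈ Ico (0 : ℝ) 1 := by
  refine ⟨Real.sin_nonneg_of_nonneg_of_le_pi hθ.1 (by linarith [hθ.2, Real.pi_pos]), ?_⟩
  rw [← Real.sin_pi_div_two]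
  exact Real.sin_lt_sin_of_lt_of_le_pi_div_two (by linarith [hθ.1, Real.pi_pos]) le_rfl hθ.2

/-- Isolates the deviation of `k` from `-K`: the first term is continuous up to `π / 2`, the second
factor diverges there. -/
lemma profile_sin (ha : 0 < (N + β) / 4 - 1) (hb : 0 < (N - β) / 4) (k : ℝ) {θ : ℝ}
    (hθ : θ ∈ Ico 0 (Real.pi / 2)) :
    profile N β k (Real.sin θ ^ 2) = angular ((N + β) / 4 - 1) ((N - β) / 4) (Real.sin θ) +
      (k + K N β) * (Real.sin θ * ordinaryHypergeometric ((N + β) / 4 - 1 / 2)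
        ((N - β) / 4 + 1 / 2) (3 / 2) (Real.sin θ ^ 2)) := by
  have hs := sin_mem_Ico hθ
  rw [angular_eq_profile ha hb (abs_lt.2 ⟨by linarith [hs.1], hs.2⟩), profile,
    Real.sqrt_sq hs.1]
  ring

lemma tendsto_sin_mul_ordinaryHypergeometric {a b : ℝ} (ha : 0 < a) (hb : 0 < b)
    (hab : 3 / 2 ≤ a + b) :
    Tendsto (fun θ => Real.sin θ * ordinaryHypergeometric a b (3 / 2) (Real.sin θ ^ 2))
      (𝓝[<] (Real.pi / 2)) atTop := by
  have h1 : Tendsto Real.sin (𝓝[<] (Real.pi / 2)) (𝓝 1) := by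
    rw [← Real.sin_pi_div_two]
    exact Real.continuous_sin.continuousAt.mono_left nhdsWithin_le_nhds
  refine h1.pos_mul_atTop one_pos ((tendsto_ordinaryHypergeometric_atTop ha hb (by norm_num)
    hab).comp (tendsto_nhdsWithin_iff.2 ⟨by simpa using h1.pow 2, ?_⟩))
  filter_upwards [Ioo_mem_nhdsLT (show (0 : ℝ) < Real.pi / 2 by positivity)] with θ hθ
  have := sin_mem_Ico ⟨hθ.1.le, hθ.2⟩
  exact pow_lt_one₀ this.1 this.2 two_ne_zero

lemma tendsto_angular_sin {a b : ℝ} (ha : 0 < a) (hb : 0 < b) :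
    Tendsto (fun θ => angular a b (Real.sin θ)) (𝓝[<] (Real.pi / 2)) (𝓝 (angular a b 1)) := by
  have h1 : Tendsto Real.sin (𝓝[<] (Real.pi / 2)) (𝓝 1) := by
    rw [← Real.sin_pi_div_two]
    exact Real.continuous_sin.continuousAt.mono_left nhdsWithin_le_nhds
  exact (hasDerivAt_angular ha hb (by norm_num)).continuousAt.tendsto.comp h1

lemma profile_eventuallyEq (ha : 0 < (N + β) / 4 - 1) (hb : 0 < (N - β) / 4) (k : ℝ) :
    (fun θ => profile N β k (Real.sin θ ^ 2)) =ᶠ[𝓝[<] (Real.pi / 2)]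
      fun θ => angular ((N + β) / 4 - 1) ((N - β) / 4) (Real.sin θ) +
      (k + K N β) * (Real.sin θ * ordinaryHypergeometric ((N + β) / 4 - 1 / 2)
        ((N - β) / 4 + 1 / 2) (3 / 2) (Real.sin θ ^ 2)) := by
  filter_upwards [Ioo_mem_nhdsLT (show (0 : ℝ) < Real.pi / 2 by positivity)] with θ hθ
  exact profile_sin ha hb k ⟨hθ.1.le, hθ.2⟩

/-- For `k ≠ -K` the profile blows up at `π / 2`. -/
lemma tendsto_abs_profile_atTop (hN : 3 ≤ N) (ha : 0 < (N + β) / 4 - 1) (hb : 0 < (N - β) / 4)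
    {k : ℝ} (hk : k ≠ -K N β) :
    Tendsto (fun θ => |profile N β k (Real.sin θ ^ 2)|) (𝓝[<] (Real.pi / 2)) atTop := by
  have hk' : k + K N β ≠ 0 := fun h => hk (by linarith)
  have h1 := tendsto_angular_sin ha hb
  have h2 := tendsto_sin_mul_ordinaryHypergeometric (a := (N + β) / 4 - 1 / 2)
    (b := (N - β) / 4 + 1 / 2) (by linarith) (by linarith) (by linarith)
  have h3 := profile_eventuallyEq ha hb k
  rcases lt_or_gt_of_ne hk' with h | h
  · exact tendsto_abs_atBot_atTop.comp
      ((h1.add_atBot (h2.const_mul_atTop_of_neg h)).congr' h3.symm)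
  · exact tendsto_abs_atTop_atTop.comp
      ((h1.add_atTop (h2.const_mul_atTop h)).congr' h3.symm)

lemma profile_bounded_iff (hN : 3 ≤ N) (ha : 0 < (N + β) / 4 - 1) (hb : 0 < (N - β) / 4)
    (k : ℝ) : (∃ C : ℝ, ∀ θ ∈ Ico 0 (Real.pi / 2), |profile N β k (Real.sin θ ^ 2)| ≤ C) ↔
      k = -K N β := by
  constructor
  · rintro ⟨C, hC⟩
    by_contra hk
    obtain ⟨θ, h1, h2⟩ := (((tendsto_abs_profile_atTop hN ha hb hk).eventually
      (eventually_gt_atTop C)).and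
        (Ioo_mem_nhdsLT (show (0 : ℝ) < Real.pi / 2 by positivity))).exists
    exact absurd (hC θ ⟨h2.1.le, h2.2⟩) (not_le.2 h1)
  · rintro rfl
    obtain ⟨C, hC⟩ := (isCompact_Icc (a := (0 : ℝ)) (b := 1)).exists_bound_of_continuousOn
      (f := angular ((N + β) / 4 - 1) ((N - β) / 4)) (fun x hx =>
        (hasDerivAt_angular ha hb (by linarith [hx.1])).continuousAt.continuousWithinAt)
    refine ⟨C, fun θ hθ => ?_⟩
    have hs := sin_mem_Ico hθ
    rw [profile_sin ha hb _ hθ, neg_add_cancel, zero_mul, add_zero]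
    exact hC _ ⟨hs.1, hs.2.le⟩

lemma profile_tendsto_iff (hN : 3 ≤ N) (ha : 0 < (N + β) / 4 - 1) (hb : 0 < (N - β) / 4)
    (k : ℝ) : (∃ L : ℝ, Tendsto (fun θ => profile N β k (Real.sin θ ^ 2))
      (𝓝[<] (Real.pi / 2)) (𝓝 L)) ↔ k = -K N β := by
  constructor
  · rintro ⟨L, hL⟩
    by_contra hk
    exact not_tendsto_nhds_of_tendsto_atTop (tendsto_abs_profile_atTop hN ha hb hk) _ hL.abs
  · rintro rfl
    refine ⟨_, (tendsto_angular_sin ha hb).congr' ?_⟩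
    filter_upwards [profile_eventuallyEq ha hb (-K N β)] with θ hθ
    simp [hθ]

end Profile

/-! ### Regularity of the squared polar and Finsler duality. -/

section Polar

variable {n : ℕ} {H : EuclideanSpace ℝ (Fin n) → ℝ}

namespace IsFinslerNorm

lemma map_zero (hH : IsFinslerNorm H) : H 0 = 0 := by
  simpa using hH.homogeneous 0 0

lemma pos (hH : IsFinslerNorm H) {ξ : EuclideanSpace ℝ (Fin n)} (hξ : ξ ≠ 0) : 0 < H ξ := by
  obtain ⟨γ₁, γ₂, h1, -, h⟩ := hH.bound
  exact (mul_pos h1 (norm_pos_iff.2 hξ)).trans_le (h ξ).1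

lemma nonneg (hH : IsFinslerNorm H) (ξ : EuclideanSpace ℝ (Fin n)) : 0 ≤ H ξ := by
  rcases eq_or_ne ξ 0 with rfl | h
  · exact hH.map_zero.ge
  · exact (hH.pos h).le

lemma differentiableAt (hH : IsFinslerNorm H) {ξ : EuclideanSpace ℝ (Fin n)} (hξ : ξ ≠ 0) :
    DifferentiableAt ℝ H ξ :=
  (hH.contDiffOn.contDiffAt (isOpen_compl_singleton.mem_nhds hξ)).differentiableAt two_ne_zero

lemma continuous (hH : IsFinslerNorm H) : Continuous H := by
  rw [continuous_iff_continuousAt]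
  intro ξ
  rcases eq_or_ne ξ 0 with rfl | h
  · obtain ⟨γ₁, γ₂, h1, -, h⟩ := hH.bound
    rw [ContinuousAt, hH.map_zero]
    have h2 : Tendsto (fun ξ : EuclideanSpace ℝ (Fin n) => γ₂ * ‖ξ‖) (𝓝 0) (𝓝 0) := by
      have : Continuous (fun ξ : EuclideanSpace ℝ (Fin n) => γ₂ * ‖ξ‖) := by fun_prop
      simpa using this.tendsto 0
    exact squeeze_zero hH.nonneg (fun ξ => (h ξ).2) h2
  · exact (hH.differentiableAt h).continuousAt

lemma isCompact_sphere (hH : IsFinslerNorm H) : IsCompact {ξ | H ξ = 1} := by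
  obtain ⟨γ₁, γ₂, h1, -, h⟩ := hH.bound
  refine Metric.isCompact_of_isClosed_isBounded (isClosed_eq hH.continuous continuous_const) ?_
  refine (Metric.isBounded_closedBall (x := (0 : EuclideanSpace ℝ (Fin n)))
    (r := 1 / γ₁)).subset fun ξ hξ => ?_
  rw [mem_closedBall_zero_iff, le_div_iff₀ h1, mul_comm]
  exact (h ξ).1.trans hξ.le

lemma inner_le (hH : IsFinslerNorm H) (ξ x : EuclideanSpace ℝ (Fin n)) :
    inner ℝ ξ x ≤ polar H x * H ξ := by
  rcases eq_or_ne ξ 0 with rfl | hξ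
  · simp [hH.map_zero]
  · obtain ⟨γ₁, γ₂, h1, -, h⟩ := hH.bound
    rw [← div_le_iff₀ (hH.pos hξ)]
    refine le_ciSup (f := fun ξ : {ξ : EuclideanSpace ℝ (Fin n) // ξ ≠ 0} =>
      inner ℝ ξ.1 x / H ξ.1) ⟨‖x‖ / γ₁, ?_⟩ ⟨ξ, hξ⟩
    rintro _ ⟨⟨η, hη⟩, rfl⟩
    simp only
    rw [div_le_div_iff₀ (hH.pos hη) h1]
    have h2 := real_inner_le_norm η x
    have h3 := (h η).1
    nlinarith [norm_nonneg x]

lemma polar_zero : polar H 0 = 0 := by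
  simp [polar]

lemma exists_maximizer (hH : IsFinslerNorm H) {x : EuclideanSpace ℝ (Fin n)} (hx : x ≠ 0) :
    ∃ ξ, H ξ = 1 ∧ inner ℝ ξ x = polar H x := by
  have hnorm : ∀ η, η ≠ 0 → H ((H η)⁻¹ • η) = 1 := fun η hη => by
    rw [hH.homogeneous, abs_of_pos (inv_pos.2 (hH.pos hη)), inv_mul_cancel₀ (hH.pos hη).ne']
  obtain ⟨ξ, hξ, hmax⟩ := hH.isCompact_sphere.exists_isMaxOn ⟨_, hnorm x hx⟩
    (f := fun ξ => inner ℝ ξ x) (by fun_prop)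
  refine ⟨ξ, hξ, le_antisymm ?_ ?_⟩
  · simpa [show H ξ = 1 from hξ] using hH.inner_le ξ x
  · have : Nonempty {ξ : EuclideanSpace ℝ (Fin n) // ξ ≠ 0} := ⟨⟨x, hx⟩⟩
    refine ciSup_le fun η => ?_
    have := hmax (hnorm η.1 η.2)
    simpa [inner_smul_left, div_eq_inv_mul] using this

lemma polar_pos (hH : IsFinslerNorm H) {x : EuclideanSpace ℝ (Fin n)} (hx : x ≠ 0) :
    0 < polar H x := by
  have h := hH.inner_le x x
  have h2 : 0 < inner ℝ x x := real_inner_self_pos.2 hx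
  exact pos_of_mul_pos_left (h2.trans_le h) (hH.nonneg x)

lemma polar_le (hH : IsFinslerNorm H) : ∃ C, 0 < C ∧
    (∀ ξ, H ξ = 1 → ‖ξ‖ ≤ C) ∧ ∀ x, polar H x ≤ C * ‖x‖ := by
  obtain ⟨γ₁, γ₂, h1, -, h⟩ := hH.bound
  have hb : ∀ ξ, H ξ = 1 → ‖ξ‖ ≤ 1 / γ₁ := fun ξ hξ => by
    rw [le_div_iff₀ h1, mul_comm]
    exact (h ξ).1.trans hξ.le
  refine ⟨1 / γ₁, by positivity, hb, fun x => ?_⟩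
  rcases eq_or_ne x 0 with rfl | hx
  · simp [polar_zero]
  · obtain ⟨ξ, hξ, hm⟩ := hH.exists_maximizer hx
    rw [← hm]
    refine (real_inner_le_norm ξ x).trans ?_
    gcongr
    exact hb ξ hξ

/-- If two maximizers differed, their midpoint would be interior to the unit ball and still maximal;
a small push along `x` would raise the pairing above its maximum. -/
lemma maximizer_unique (hH : IsFinslerNorm H) {x ξ η : EuclideanSpace ℝ (Fin n)} (hx : x ≠ 0)
    (hξ : H ξ = 1) (hη : H η = 1) (h1 : inner ℝ ξ x = polar H x)
    (h2 : inner ℝ η x = polar H x) : ξ = η := by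
  by_contra hne
  have hmid := hH.strictConvex (show ξ ∈ {ξ | H ξ ≤ 1} from hξ.le)
    (show η ∈ {ξ | H ξ ≤ 1} from hη.le) hne (show (0 : ℝ) < 1 / 2 by norm_num)
    (show (0 : ℝ) < 1 / 2 by norm_num) (by norm_num)
  set m := (1 / 2 : ℝ) • ξ + (1 / 2 : ℝ) • η with hm
  have hc : Tendsto (fun ε : ℝ => m + ε • x) (𝓝[>] 0) (𝓝 m) := by
    have : Continuous fun ε : ℝ => m + ε • x := by fun_prop
    simpa using (this.tendsto 0).mono_left nhdsWithin_le_nhds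
  obtain ⟨ε, hε, hε0⟩ := ((hc.eventually (mem_interior_iff_mem_nhds.1 hmid)).and
    self_mem_nhdsWithin).exists
  have h3 := hH.inner_le (m + ε • x) x
  have h4 : inner ℝ m x = polar H x := by
    rw [hm, inner_add_left, inner_smul_left, inner_smul_left, h1, h2]
    simp; ring
  rw [inner_add_left, inner_smul_left, h4] at h3
  have h5 : 0 < inner ℝ x x := real_inner_self_pos.2 hx
  have h6 : polar H x * H (m + ε • x) ≤ polar H x * 1 :=
    mul_le_mul_of_nonneg_left hε (hH.polar_pos hx).le
  have h7 : 0 < ε * inner ℝ x x := mul_pos hε0 h5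
  simp only [RCLike.conj_to_real] at h3
  linarith

end IsFinslerNorm

open Classical in
/-- A point of `{H = 1}` at which `⟨·, x⟩` is maximal. -/
def maximizer (H : EuclideanSpace ℝ (Fin n) → ℝ) (x : EuclideanSpace ℝ (Fin n)) :
    EuclideanSpace ℝ (Fin n) :=
  -- The value at `x = 0` is immaterial: `polarSqGrad` multiplies it by `polar H 0 = 0`.
  if h : ∃ ξ, H ξ = 1 ∧ inner ℝ ξ x = polar H x then h.choose else 0

/-- The gradient of `polar H ^ 2`. -/
def polarSqGrad (H : EuclideanSpace ℝ (Fin n) → ℝ) (x : EuclideanSpace ℝ (Fin n)) :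
    EuclideanSpace ℝ (Fin n) :=
  (2 * polar H x) • maximizer H x

namespace IsFinslerNorm

lemma maximizer_spec (hH : IsFinslerNorm H) {x : EuclideanSpace ℝ (Fin n)} (hx : x ≠ 0) :
    H (maximizer H x) = 1 ∧ inner ℝ (maximizer H x) x = polar H x := by
  have h := hH.exists_maximizer hx
  rw [maximizer, dif_pos h]
  exact h.choose_spec

/-- Each maximizer is a competitor at the other point. This sandwich drives both continuity and
differentiability of the polar. -/
lemma polar_sub_bounds (hH : IsFinslerNorm H) {x y : EuclideanSpace ℝ (Fin n)} (hx : x ≠ 0)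
    (hy : y ≠ 0) : inner ℝ (maximizer H x) (y - x) ≤ polar H y - polar H x ∧
      polar H y - polar H x ≤ inner ℝ (maximizer H y) (y - x) := by
  have hx' := hH.maximizer_spec hx
  have hy' := hH.maximizer_spec hy
  have h1 := hH.inner_le (maximizer H x) y
  have h2 := hH.inner_le (maximizer H y) x
  rw [hx'.1] at h1
  rw [hy'.1] at h2
  rw [inner_sub_right, inner_sub_right, hx'.2, hy'.2]
  constructor <;> linarith

lemma continuousAt_polar (hH : IsFinslerNorm H) {x : EuclideanSpace ℝ (Fin n)} (hx : x ≠ 0) :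
    ContinuousAt (polar H) x := by
  obtain ⟨C, hC, hb, -⟩ := hH.polar_le
  rw [ContinuousAt, tendsto_iff_norm_sub_tendsto_zero]
  have h0 : Tendsto (fun y => C * ‖y - x‖) (𝓝 x) (𝓝 0) := by
    have : Continuous fun y => C * ‖y - x‖ := by fun_prop
    simpa using this.tendsto x
  refine squeeze_zero' (Eventually.of_forall fun y => norm_nonneg _) ?_ h0
  filter_upwards [isOpen_ne.mem_nhds hx] with y hy
  have h := hH.polar_sub_bounds hx hy
  have h1 := abs_real_inner_le_norm (maximizer H x) (y - x)
  have h2 := abs_real_inner_le_norm (maximizer H y) (y - x)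
  have h3 := mul_le_mul_of_nonneg_right (hb _ (hH.maximizer_spec hx).1) (norm_nonneg (y - x))
  have h4 := mul_le_mul_of_nonneg_right (hb _ (hH.maximizer_spec hy).1) (norm_nonneg (y - x))
  rw [Real.norm_eq_abs, abs_le]
  have h5 := abs_le.1 (h1.trans h3)
  have h6 := abs_le.1 (h2.trans h4)
  constructor <;> linarith [h.1, h.2, h5.1, h6.2]

/-- By compactness of `{H = 1}` it suffices that every cluster point is a maximizer at `x`;
uniqueness then identifies it. -/
lemma continuousAt_maximizer (hH : IsFinslerNorm H) {x : EuclideanSpace ℝ (Fin n)} (hx : x ≠ 0) :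
    ContinuousAt (maximizer H) x := by
  have hev : ∀ᶠ y in 𝓝 x, y ≠ 0 := isOpen_ne.mem_nhds hx
  refine hH.isCompact_sphere.tendsto_nhds_of_unique_mapClusterPt
    (hev.mono fun y hy => (hH.maximizer_spec hy).1) fun η hη hcl => ?_
  refine hH.maximizer_unique hx hη (hH.maximizer_spec hx).1 ?_ (hH.maximizer_spec hx).2
  obtain ⟨C, hC, hb, -⟩ := hH.polar_le
  have ht : Tendsto (fun y => inner ℝ (maximizer H y) x) (𝓝 x) (𝓝 (polar H x)) := by
    have h0 : Tendsto (fun y => C * ‖y - x‖) (𝓝 x) (𝓝 0) := by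
      have : Continuous fun y => C * ‖y - x‖ := by fun_prop
      simpa using this.tendsto x
    have h1 : Tendsto (fun y => inner ℝ (maximizer H y) (y - x)) (𝓝 x) (𝓝 0) := by
      refine squeeze_zero_norm' (hev.mono fun y hy => ?_) h0
      exact (norm_inner_le_norm _ _).trans
        (mul_le_mul_of_nonneg_right (hb _ (hH.maximizer_spec hy).1) (norm_nonneg _))
    have h2 := (hH.continuousAt_polar hx).tendsto.sub h1
    rw [sub_zero] at h2
    refine h2.congr' (hev.mono fun y hy => ?_)
    rw [inner_sub_right, (hH.maximizer_spec hy).2]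
    ring
  have hcl' : MapClusterPt (inner ℝ η x) (𝓝 x) (fun y => inner ℝ (maximizer H y) x) :=
    hcl.continuousAt_comp (f := fun ξ : EuclideanSpace ℝ (Fin n) => inner ℝ ξ x)
      (by fun_prop)
  have : (𝓝 (inner ℝ η x) ⊓ 𝓝 (polar H x)).NeBot := ClusterPt.mono hcl' ht
  exact eq_of_nhds_neBot this

/-- The gap between the two sides of `polar_sub_bounds` is at most the variation of the maximizer
times `‖y - x‖`. -/
lemma hasFDerivAt_polar (hH : IsFinslerNorm H) {x : EuclideanSpace ℝ (Fin n)} (hx : x ≠ 0) :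
    HasFDerivAt (polar H) (innerSL ℝ (maximizer H x)) x := by
  rw [hasFDerivAt_iff_isLittleO, Asymptotics.isLittleO_iff]
  intro c hc
  have hcont := Metric.tendsto_nhds.1 (hH.continuousAt_maximizer hx) c hc
  filter_upwards [hcont, isOpen_ne.mem_nhds hx] with y hy hy0
  have h := hH.polar_sub_bounds hx hy0
  rw [innerSL_apply_apply, Real.norm_eq_abs, abs_of_nonneg (by linarith [h.1])]
  calc polar H y - polar H x - inner ℝ (maximizer H x) (y - x)
      ≤ inner ℝ (maximizer H y - maximizer H x) (y - x) := by
        rw [inner_sub_left]; linarith [h.2]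
    _ ≤ ‖maximizer H y - maximizer H x‖ * ‖y - x‖ := real_inner_le_norm _ _
    _ ≤ c * ‖y - x‖ := by
        rw [dist_eq_norm] at hy
        gcongr

lemma norm_polarSqGrad_le (hH : IsFinslerNorm H) :
    ∃ C, 0 < C ∧ ∀ x, ‖polarSqGrad H x‖ ≤ C * ‖x‖ := by
  obtain ⟨C, hC, hb, hp⟩ := hH.polar_le
  refine ⟨2 * C * C, by positivity, fun x => ?_⟩
  rcases eq_or_ne x 0 with rfl | hx
  · simp [polarSqGrad, polar_zero]
  · have h1 := hb _ (hH.maximizer_spec hx).1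
    have h2 := hp x
    have h3 := hH.polar_pos hx
    rw [polarSqGrad, norm_smul, Real.norm_of_nonneg (by positivity)]
    calc 2 * polar H x * ‖maximizer H x‖ ≤ 2 * (C * ‖x‖) * C := by gcongr
      _ = _ := by ring

lemma polarSqGrad_zero : polarSqGrad H 0 = 0 := by
  simp [polarSqGrad, polar_zero]

/-- Squaring removes the singularity at the origin, where the polar is only bounded by a multiple of
the norm. -/
lemma hasFDerivAt_polar_sq (hH : IsFinslerNorm H) (x : EuclideanSpace ℝ (Fin n)) :
    HasFDerivAt (fun y => polar H y ^ 2) (innerSL ℝ (polarSqGrad H x)) x := by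
  rcases eq_or_ne x 0 with rfl | hx
  · obtain ⟨C, hC, -, hp⟩ := hH.polar_le
    rw [polarSqGrad_zero, _root_.map_zero]
    refine HasFDerivAt.of_isLittleO ?_
    have hO : (fun y : EuclideanSpace ℝ (Fin n) => polar H y ^ 2) =O[𝓝 0]
        fun y => ‖y - 0‖ ^ 2 := by
      refine Asymptotics.IsBigO.of_bound (C ^ 2) (Eventually.of_forall fun y => ?_)
      have h0 : 0 ≤ polar H y := by
        rcases eq_or_ne y 0 with rfl | hy
        · exact polar_zero.ge
        · exact (hH.polar_pos hy).le
      rw [norm_pow, norm_pow, ← mul_pow, Real.norm_of_nonneg h0, sub_zero, norm_norm]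
      exact pow_le_pow_left₀ h0 (hp y) 2
    have ho : (fun y : EuclideanSpace ℝ (Fin n) => ‖y - 0‖ ^ 2) =o[𝓝 0] fun y => y - 0 := by
      simpa using Asymptotics.isLittleO_norm_pow_id (E' := EuclideanSpace ℝ (Fin n)) one_lt_two
    simpa [polar_zero] using hO.trans_isLittleO ho
  · have h := (hH.hasFDerivAt_polar hx).pow 2
    convert! h using 1
    ext v
    simp [polarSqGrad]

lemma continuous_polarSqGrad (hH : IsFinslerNorm H) : Continuous (polarSqGrad H) := by
  rw [continuous_iff_continuousAt]
  intro x
  rcases eq_or_ne x 0 with rfl | hx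
  · obtain ⟨C, hC, hp⟩ := hH.norm_polarSqGrad_le
    rw [ContinuousAt, polarSqGrad_zero]
    have h2 : Tendsto (fun ξ : EuclideanSpace ℝ (Fin n) => C * ‖ξ‖) (𝓝 0) (𝓝 0) := by
      have : Continuous (fun ξ : EuclideanSpace ℝ (Fin n) => C * ‖ξ‖) := by fun_prop
      simpa using this.tendsto 0
    exact squeeze_zero_norm hp h2
  · exact (continuousAt_const.mul (hH.continuousAt_polar hx)).smul (hH.continuousAt_maximizer hx)

lemma contDiff_polar_sq (hH : IsFinslerNorm H) : ContDiff ℝ 1 (fun y => polar H y ^ 2) := by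
  rw [contDiff_one_iff_fderiv]
  refine ⟨fun x => (hH.hasFDerivAt_polar_sq x).differentiableAt, ?_⟩
  rw [show fderiv ℝ (fun y => polar H y ^ 2) = fun x => innerSL ℝ (polarSqGrad H x) from
    funext fun x => (hH.hasFDerivAt_polar_sq x).fderiv]
  exact (innerSL ℝ).continuous.comp hH.continuous_polarSqGrad

lemma inner_polarSqGrad_self (hH : IsFinslerNorm H) (x : EuclideanSpace ℝ (Fin n)) :
    inner ℝ (polarSqGrad H x) x = 2 * polar H x ^ 2 := by
  rcases eq_or_ne x 0 with rfl | hx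
  · simp [polar_zero]
  · rw [polarSqGrad, inner_smul_left, (hH.maximizer_spec hx).2]
    simp; ring

/-- First-order condition: `ξ ↦ polar H x * H ξ - s⟨ξ, x⟩` is nonnegative and vanishes at `η`. The
sign `s` allows for negative multiples of a maximizer. -/
lemma polar_smul_gradient (hH : IsFinslerNorm H) {x η : EuclideanSpace ℝ (Fin n)} {s : ℝ}
    (hs : |s| = 1) (hη : η ≠ 0) (h : s * inner ℝ η x = polar H x * H η) :
    polar H x • gradient H η = s • x := by
  have hd := ((hH.differentiableAt hη).hasGradientAt.hasFDerivAt.const_mul (polar H x)).sub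
    ((innerSL ℝ (s • x)).hasFDerivAt (x := η))
  have hmin : IsLocalMin (fun ξ => polar H x * H ξ - innerSL ℝ (s • x) ξ) η := by
    refine Eventually.of_forall fun ξ => ?_
    have h1 := hH.inner_le (s • ξ) x
    rw [hH.homogeneous, hs, one_mul, inner_smul_left] at h1
    simp only [innerSL_apply_apply, inner_smul_left, RCLike.conj_to_real] at h1 ⊢
    rw [real_inner_comm, real_inner_comm ξ, h, sub_self]
    linarith
  have h0 := hmin.hasFDerivAt_eq_zero hd
  refine ext_inner_right ℝ fun v => ?_
  have := DFunLike.congr_fun h0 v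
  simp [inner_smul_left] at this ⊢
  linarith

/-- Duality: the Finsler flux inverts the gradient of the square of the polar. -/
lemma smul_gradient_polarSqGrad (hH : IsFinslerNorm H) (c : ℝ) (x : EuclideanSpace ℝ (Fin n)) :
    H (c • polarSqGrad H x) • gradient H (c • polarSqGrad H x) = (2 * c) • x := by
  rcases eq_or_ne x 0 with rfl | hx
  · simp [polarSqGrad_zero, hH.map_zero]
  rcases eq_or_ne c 0 with rfl | hc
  · simp [hH.map_zero]
  have hp := hH.polar_pos hx
  have hm := hH.maximizer_spec hx
  have hm0 : maximizer H x ≠ 0 := fun h => by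
    have := hm.1; rw [h, hH.map_zero] at this; norm_num at this
  have hval : H (c • polarSqGrad H x) = 2 * |c| * polar H x := by
    rw [polarSqGrad, smul_smul, hH.homogeneous, hm.1, mul_one, abs_mul,
      abs_of_pos (show 0 < 2 * polar H x by positivity)]
    ring
  have hg := hH.polar_smul_gradient (x := x) (η := c • polarSqGrad H x) (s := SignType.sign c)
    (by rcases hc.lt_or_gt with h | h <;> simp [h])
    (smul_ne_zero hc (smul_ne_zero (by positivity) hm0)) (by
      rw [hval, inner_smul_left, hH.inner_polarSqGrad_self]
      rw [RCLike.conj_to_real, ← mul_assoc, sign_mul_self]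
      ring)
  rw [hval, mul_smul, hg, smul_smul]
  congr 1
  rw [mul_assoc, abs_mul_sign]

end IsFinslerNorm

end Polar

/-! ### Second-order regularity under a positive definite Hessian. -/

section Ellipticity

variable {n : ℕ} {H : EuclideanSpace ℝ (Fin n) → ℝ}

namespace IsFinslerNorm

lemma gradient_sq (hH : IsFinslerNorm H) {ξ : EuclideanSpace ℝ (Fin n)} (hξ : ξ ≠ 0) :
    gradient (fun η => H η ^ 2) ξ = (2 : ℝ) • (H ξ • gradient H ξ) := by
  have h := (hH.differentiableAt hξ).hasGradientAt.hasFDerivAt.pow 2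
  refine HasGradientAt.gradient ?_
  rw [hasGradientAt_iff_hasFDerivAt]
  convert! h using 1
  ext v
  simp [mul_assoc]

lemma contDiffAt_gradient_sq (hH : IsFinslerNorm H) {ξ : EuclideanSpace ℝ (Fin n)} (hξ : ξ ≠ 0) :
    ContDiffAt ℝ 1 (gradient fun η => H η ^ 2) ξ := by
  have h : ContDiffAt ℝ 2 (fun η => H η ^ 2) ξ :=
    (hH.contDiffOn.contDiffAt (isOpen_compl_singleton.mem_nhds hξ)).pow 2
  exact (InnerProductSpace.toDual ℝ (EuclideanSpace ℝ (Fin n))).symm.contDiff.contDiffAt.comp ξ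
    (h.fderiv_right (m := 1) (by norm_num))

/-- The derivative of `∇(H²)` is invertible where the Hessian is positive definite. -/
lemma exists_hasFDerivAt_gradient_sq (hH : IsFinslerNorm H) (hpd : HasPosDefHessian H)
    {ξ : EuclideanSpace ℝ (Fin n)} (hξ : ξ ≠ 0) :
    ∃ A : EuclideanSpace ℝ (Fin n) ≃L[ℝ] EuclideanSpace ℝ (Fin n),
      HasFDerivAt (gradient fun η => H η ^ 2)
        (A : EuclideanSpace ℝ (Fin n) →L[ℝ] EuclideanSpace ℝ (Fin n)) ξ := by
  have h : ContDiffAt ℝ 2 (fun η => H η ^ 2) ξ :=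
    (hH.contDiffOn.contDiffAt (isOpen_compl_singleton.mem_nhds hξ)).pow 2
  have hd : DifferentiableAt ℝ (fderiv ℝ fun η => H η ^ 2) ξ :=
    (h.fderiv_right (m := 1) (by norm_num)).differentiableAt one_ne_zero
  have hg := (hH.contDiffAt_gradient_sq hξ).differentiableAt one_ne_zero
  set B := fderiv ℝ (gradient fun η => H η ^ 2) ξ with hB
  have hval : ∀ v, inner ℝ (B v) v = iteratedFDeriv ℝ 2 (fun η => H η ^ 2) ξ ![v, v] := by
    intro v
    rw [iteratedFDeriv_two_apply]
    have h1 : HasFDerivAt (fun η => inner ℝ (gradient (fun η => H η ^ 2) η) v)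
        ((innerSL ℝ v).comp B) ξ := by
      have := ((innerSL ℝ v).hasFDerivAt.comp ξ hg.hasFDerivAt)
      refine this.congr_of_eventuallyEq (Eventually.of_forall fun η => ?_)
      simp
    have h2 : HasFDerivAt (fun η => fderiv ℝ (fun η => H η ^ 2) η v)
        ((ContinuousLinearMap.apply ℝ ℝ v).comp (fderiv ℝ (fderiv ℝ fun η => H η ^ 2) ξ)) ξ :=
      (ContinuousLinearMap.apply ℝ ℝ v).hasFDerivAt.comp ξ hd.hasFDerivAt
    have h3 : (fun η => inner ℝ (gradient (fun η => H η ^ 2) η) v) =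
        fun η => fderiv ℝ (fun η => H η ^ 2) η v := by
      ext η; simp [gradient]
    rw [h3] at h1
    have := DFunLike.congr_fun (h1.unique h2) v
    simpa [real_inner_comm] using this
  have hinj : Function.Injective B.toLinearMap := by
    rw [← LinearMap.ker_eq_bot, LinearMap.ker_eq_bot']
    intro v hv
    by_contra hne
    have h1 := hpd ξ hξ v hne
    rw [← hval v, show B v = 0 from hv, inner_zero_left] at h1
    exact lt_irrefl _ h1
  refine ⟨(LinearEquiv.ofInjectiveEndo B.toLinearMap hinj).toContinuousLinearEquiv, ?_⟩
  convert! hg.hasFDerivAt using 1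

/-- By duality `polarSqGrad H / 4` is a right inverse of `∇(H²)` away from the origin, so the
inverse function theorem transfers `C¹` regularity to it. -/
lemma contDiffAt_polarSqGrad (hH : IsFinslerNorm H) (hpd : HasPosDefHessian H)
    {x : EuclideanSpace ℝ (Fin n)} (hx : x ≠ 0) : ContDiffAt ℝ 1 (polarSqGrad H) x := by
  have hS : ∀ y, y ≠ 0 → (1 / 4 : ℝ) • polarSqGrad H y ≠ 0 ∧
      gradient (fun η => H η ^ 2) ((1 / 4 : ℝ) • polarSqGrad H y) = y := by
    intro y hy
    have h1 := hH.smul_gradient_polarSqGrad (1 / 4) y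
    have h0 : (1 / 4 : ℝ) • polarSqGrad H y ≠ 0 := fun h => by
      rw [h, hH.map_zero, zero_smul] at h1
      exact smul_ne_zero (by norm_num) hy h1.symm
    refine ⟨h0, ?_⟩
    rw [hH.gradient_sq h0, h1, smul_smul]
    norm_num
  obtain ⟨A, hA⟩ := hH.exists_hasFDerivAt_gradient_sq hpd (hS x hx).1
  have hc := hH.contDiffAt_gradient_sq (hS x hx).1
  have hinv := hc.to_localInverse hA one_ne_zero
  rw [(hS x hx).2] at hinv
  -- Continuity keeps this right inverse where the local inverse is valid, so the two agree near
  -- `x`.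
  have hcont : Tendsto (fun y => (1 / 4 : ℝ) • polarSqGrad H y) (𝓝 x)
      (𝓝 ((1 / 4 : ℝ) • polarSqGrad H x)) :=
    (hH.continuous_polarSqGrad.const_smul (1 / 4 : ℝ)).tendsto x
  have hev := hcont.eventually (hc.hasStrictFDerivAt' hA one_ne_zero).eventually_left_inverse
  have h4 : polarSqGrad H =ᶠ[𝓝 x] fun y => (4 : ℝ) • hc.localInverse hA one_ne_zero y := by
    filter_upwards [hev, isOpen_ne.mem_nhds hx] with y hy hy0
    rw [(hS y hy0).2] at hy
    rw [ContDiffAt.localInverse, hy, smul_smul]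
    norm_num
  exact (hinv.const_smul (4 : ℝ)).congr_of_eventuallyEq h4

lemma contDiffAt_polar_sq_two (hH : IsFinslerNorm H) (hpd : HasPosDefHessian H)
    {x : EuclideanSpace ℝ (Fin n)} (hx : x ≠ 0) :
    ContDiffAt ℝ 2 (fun y => polar H y ^ 2) x := by
  have hf : fderiv ℝ (fun y => polar H y ^ 2) = fun x => innerSL ℝ (polarSqGrad H x) :=
    funext fun x => (hH.hasFDerivAt_polar_sq x).fderiv
  have h : ContDiffOn ℝ (1 + 1) (fun y => polar H y ^ 2) {0}ᶜ := by
    rw [contDiffOn_succ_iff_fderiv_of_isOpen isOpen_compl_singleton, hf]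
    refine ⟨fun y _ => (hH.hasFDerivAt_polar_sq y).differentiableAt.differentiableWithinAt,
      by simp, fun y hy => ?_⟩
    exact ((innerSL ℝ).contDiff.contDiffAt.comp y
      (hH.contDiffAt_polarSqGrad hpd hy)).contDiffWithinAt
  rw [one_add_one_eq_two] at h
  exact h.contDiffAt (isOpen_compl_singleton.mem_nhds hx)

end IsFinslerNorm

end Ellipticity

/-! ### Calculus of homogeneous functions of `(s, t)`. -/

section HomogeneousProfile

/-- The function `ρ ^ (-2e) f(t / ρ)` with `ρ² = s + t²`. -/
def homogeneousProfile (e : ℝ) (f : ℝ → ℝ) (p : ℝ × ℝ) : ℝ :=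
  (p.1 + p.2 ^ 2) ^ (-e) * f (p.2 / √(p.1 + p.2 ^ 2))

lemma contDiffAt_homogeneousProfile {e : ℝ} {f : ℝ → ℝ} {p : ℝ × ℝ} {k : WithTop ℕ∞}
    (hR : 0 < p.1 + p.2 ^ 2) (hf : ContDiffAt ℝ k f (p.2 / √(p.1 + p.2 ^ 2))) :
    ContDiffAt ℝ k (homogeneousProfile e f) p := by
  have hR' : ContDiffAt ℝ k (fun p : ℝ × ℝ => p.1 + p.2 ^ 2) p := by fun_prop
  have h1 : ContDiffAt ℝ k (fun p : ℝ × ℝ => (p.1 + p.2 ^ 2) ^ (-e)) p :=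
    hR'.rpow_const_of_ne hR.ne'
  have h2 : ContDiffAt ℝ k (fun p : ℝ × ℝ => p.2 / √(p.1 + p.2 ^ 2)) p :=
    contDiffAt_snd.div (hR'.sqrt hR.ne') (Real.sqrt_pos.2 hR).ne'
  exact h1.mul (hf.comp p h2)

/-- The family is closed under differentiation: only the exponent and the angular factor change, so
second derivatives come from reapplying the first-order rules. -/
lemma hasDerivAt_homogeneousProfile_fst {e s t : ℝ} {f f' : ℝ → ℝ} (hR : 0 < s + t ^ 2)
    (hf : HasDerivAt f (f' (t / √(s + t ^ 2))) (t / √(s + t ^ 2))) :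
    HasDerivAt (fun s => homogeneousProfile e f (s, t))
      (homogeneousProfile (e + 1) (fun x => -e * f x - x * f' x / 2) (s, t)) s := by
  have h0 : HasDerivAt (fun s => s + t ^ 2) 1 s := (hasDerivAt_id s).add_const _
  have h1 := h0.rpow_const (p := -e) (Or.inl hR.ne')
  have h2 := (hasDerivAt_const s t).div (h0.sqrt hR.ne') (Real.sqrt_pos.2 hR).ne'
  have h3 := h1.mul (hf.comp s h2)
  convert! h3 using 1
  simp only [homogeneousProfile, Function.comp_apply]
  have hs := Real.sqrt_pos.2 hR
  have hsq := Real.sq_sqrt hR.le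
  rw [neg_add e 1, Real.rpow_add hR, Real.rpow_neg_one, sub_eq_add_neg (-e), Real.rpow_add hR,
    Real.rpow_neg_one]
  set ρ := √(s + t ^ 2)
  rw [← hsq]
  generalize f (t / ρ) = F
  generalize f' (t / ρ) = F'
  generalize ((ρ ^ 2) ^ (-e) : ℝ) = Y
  field_simp
  ring

lemma hasDerivAt_homogeneousProfile_snd {e s t : ℝ} {f f' : ℝ → ℝ} (hR : 0 < s + t ^ 2)
    (hf : HasDerivAt f (f' (t / √(s + t ^ 2))) (t / √(s + t ^ 2))) :
    HasDerivAt (fun t => homogeneousProfile e f (s, t))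
      (homogeneousProfile (e + 1 / 2) (fun x => -2 * e * x * f x + (1 - x ^ 2) * f' x) (s, t))
      t := by
  have h0 : HasDerivAt (fun t => s + t ^ 2) (2 * t) t := by
    simpa using (hasDerivAt_pow 2 t).const_add s
  have h1 := h0.rpow_const (p := -e) (Or.inl hR.ne')
  have h2 := (hasDerivAt_id t).div (h0.sqrt hR.ne') (Real.sqrt_pos.2 hR).ne'
  have h3 := h1.mul (hf.comp t h2)
  convert! h3 using 1
  simp only [homogeneousProfile, Function.comp_apply, Pi.div_apply, id]
  have hs := Real.sqrt_pos.2 hR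
  have hsq := Real.sq_sqrt hR.le
  rw [neg_add e (1 / 2), Real.rpow_add hR, Real.rpow_neg hR.le (1 / 2), ← Real.sqrt_eq_rpow,
    sub_eq_add_neg (-e), Real.rpow_add hR, Real.rpow_neg_one]
  set ρ := √(s + t ^ 2)
  rw [← hsq]
  generalize f (t / ρ) = F
  generalize f' (t / ρ) = F'
  generalize ((ρ ^ 2) ^ (-e) : ℝ) = Y
  field_simp

end HomogeneousProfile

/-! ### Gradient, flux and divergence on the half-space. -/

section HalfSpace

variable {n : ℕ} {H : EuclideanSpace ℝ (Fin n) → ℝ}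

/-- `homogeneousProfile` evaluated at `s = polar H x ^ 2`. -/
def polarProfile (H : EuclideanSpace ℝ (Fin n) → ℝ) (e : ℝ) (f : ℝ → ℝ)
    (p : EuclideanSpace ℝ (Fin n) × ℝ) : ℝ :=
  homogeneousProfile e f (polar H p.1 ^ 2, p.2)

namespace IsFinslerNorm

lemma polar_sq_add_pos (hH : IsFinslerNorm H) {p : EuclideanSpace ℝ (Fin n) × ℝ} (hp : p ≠ 0) :
    0 < polar H p.1 ^ 2 + p.2 ^ 2 := by
  by_cases h : p.1 = 0
  · have : p.2 ≠ 0 := fun h2 => hp (Prod.ext h h2)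
    positivity
  · have := hH.polar_pos h
    positivity

lemma polar_sq_add_pos_of_pos {x : EuclideanSpace ℝ (Fin n)} {t : ℝ} (ht : 0 < t) :
    0 < polar H x ^ 2 + t ^ 2 := by positivity

/-- For `t ≥ 0` the ratio `t / ρ` is nonnegative, inside the smoothness domain of `f`, even on the
axis where it equals 1. Regularity is then limited only by that of `polar H ^ 2`. -/
lemma contDiffAt_polarProfile {e : ℝ} {f : ℝ → ℝ} {k : WithTop ℕ∞}
    {p : EuclideanSpace ℝ (Fin n) × ℝ} (hR : 0 < polar H p.1 ^ 2 + p.2 ^ 2) (ht : 0 ≤ p.2)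
    (hf : ContDiffOn ℝ k f (Ioi (-1))) (hQ : ContDiffAt ℝ k (fun y => polar H y ^ 2) p.1) :
    ContDiffAt ℝ k (polarProfile H e f) p := by
  have hmem : p.2 / √(polar H p.1 ^ 2 + p.2 ^ 2) ∈ Ioi (-1 : ℝ) := by
    have : 0 ≤ p.2 / √(polar H p.1 ^ 2 + p.2 ^ 2) := by positivity
    exact lt_of_lt_of_le (by norm_num) this
  have h1 := contDiffAt_homogeneousProfile (e := e) (p := (polar H p.1 ^ 2, p.2)) hR
    (hf.contDiffAt (Ioi_mem_nhds hmem))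
  exact h1.comp p ((hQ.comp p contDiffAt_fst).prodMk contDiffAt_snd)

lemma hasGradientAt_polarProfile (hH : IsFinslerNorm H) {e t : ℝ} {f f' : ℝ → ℝ} (ht : 0 < t)
    (hf : ∀ x, -1 < x → HasDerivAt f (f' x) x) (y : EuclideanSpace ℝ (Fin n)) :
    HasGradientAt (fun y => polarProfile H e f (y, t))
      (polarProfile H (e + 1) (fun x => -e * f x - x * f' x / 2) (y, t) • polarSqGrad H y) y := by
  have hx : 0 ≤ t / √(polar H y ^ 2 + t ^ 2) := by positivity
  have h := (hasDerivAt_homogeneousProfile_fst (e := e) (polar_sq_add_pos_of_pos (H := H) (x := y) ht)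
    (hf _ (by linarith))).comp_hasFDerivAt y (hH.hasFDerivAt_polar_sq y)
  rw [hasGradientAt_iff_hasFDerivAt]
  convert! h using 1
  ext v
  simp [polarProfile]

lemma finslerFlux_polarProfile (hH : IsFinslerNorm H) {e t : ℝ} {f f' : ℝ → ℝ} (ht : 0 < t)
    (hf : ∀ x, -1 < x → HasDerivAt f (f' x) x) (y : EuclideanSpace ℝ (Fin n)) :
    finslerFlux H (fun y => polarProfile H e f (y, t)) y =
      (2 * polarProfile H (e + 1) (fun x => -e * f x - x * f' x / 2) (y, t)) • y := by
  rw [finslerFlux, (hH.hasGradientAt_polarProfile ht hf y).gradient,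
    hH.smul_gradient_polarSqGrad]

/-- Product rule together with Euler's identity `⟨∇(polar H ^ 2), y⟩ = 2 polar H y ^ 2`. -/
lemma divergence_polarProfile_smul (hH : IsFinslerNorm H) {e t : ℝ} {f f' : ℝ → ℝ} (ht : 0 < t)
    (hf : ∀ x, -1 < x → HasDerivAt f (f' x) x) (y : EuclideanSpace ℝ (Fin n)) :
    divergence (fun y => (2 * polarProfile H e f (y, t)) • y) y =
      2 * n * polarProfile H e f (y, t) + 4 * polar H y ^ 2 *
        polarProfile H (e + 1) (fun x => -e * f x - x * f' x / 2) (y, t) := by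
  have h : HasFDerivAt (fun y => (2 * polarProfile H e f (y, t)) • y) _ y :=
    ((hH.hasGradientAt_polarProfile (e := e) ht hf y).hasFDerivAt.const_mul 2).smul
    (hasFDerivAt_id y)
  have hi := hH.inner_polarSqGrad_self y
  rw [divergence, h.fderiv]
  set g := polarProfile H (e + 1) (fun x => -e * f x - x * f' x / 2) (y, t)
  have hterm : ∀ j, (((2 * polarProfile H e f (y, t)) • ContinuousLinearMap.id ℝ
      (EuclideanSpace ℝ (Fin n)) + ((2 : ℝ) • (InnerProductSpace.toDual ℝ
      (EuclideanSpace ℝ (Fin n))) (g • polarSqGrad H y)).smulRight y)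
      (EuclideanSpace.single j 1)) j = 2 * polarProfile H e f (y, t) +
        2 * g * (polarSqGrad H y j * y j) := by
    intro j
    simp [EuclideanSpace.inner_single_right]
    ring
  rw [Finset.sum_congr rfl fun j _ => hterm j, Finset.sum_add_distrib, ← Finset.mul_sum _ _ (2 * g)]
  have hi' : ∑ j, polarSqGrad H y j * y j = 2 * polar H y ^ 2 := by
    rw [← hi, PiLp.inner_apply]
    simp [mul_comm]
  rw [hi']
  simp
  ring

end IsFinslerNorm

end HalfSpace

/-! ### The extended extremal and the equation it solves. -/

section Solution

variable {n : ℕ} {H : EuclideanSpace ℝ (Fin n) → ℝ} {a b : ℝ}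

/-- Radial derivative of the profile, up to a power of `ρ`. -/
def radialPart (a b : ℝ) (x : ℝ) : ℝ :=
  -((a + b) / 2) * angular a b x - x * angularDeriv a b x / 2

/-- Derivative of `radialPart`. -/
def radialPartDeriv (a b : ℝ) (x : ℝ) : ℝ :=
  -((a + b) / 2) * angularDeriv a b x -
    (1 * angularDeriv a b x + x * angularDerivTwo a b x) / 2

/-- Derivative of the profile in `t`, up to a power of `ρ`. -/
def verticalPart (a b : ℝ) (x : ℝ) : ℝ :=
  -2 * ((a + b) / 2) * x * angular a b x + (1 - x ^ 2) * angularDeriv a b x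

/-- Derivative of `verticalPart`. -/
def verticalPartDeriv (a b : ℝ) (x : ℝ) : ℝ :=
  -2 * ((a + b) / 2) * angular a b x + -2 * ((a + b) / 2) * x * angularDeriv a b x +
    (-(2 * x) * angularDeriv a b x + (1 - x ^ 2) * angularDerivTwo a b x)

lemma hasDerivAt_radialPart (ha : 0 < a) (hb : 0 < b) {x : ℝ} (hx : -1 < x) :
    HasDerivAt (radialPart a b) (radialPartDeriv a b x) x :=
  ((hasDerivAt_angular ha hb hx).const_mul _).sub
    (((hasDerivAt_id x).mul (hasDerivAt_angularDeriv ha hb hx)).div_const 2)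

lemma hasDerivAt_verticalPart (ha : 0 < a) (hb : 0 < b) {x : ℝ} (hx : -1 < x) :
    HasDerivAt (verticalPart a b) (verticalPartDeriv a b x) x := by
  have h1 := ((hasDerivAt_id x).const_mul (-2 * ((a + b) / 2))).mul (hasDerivAt_angular ha hb hx)
  have h2 := ((hasDerivAt_pow 2 x).const_sub 1).mul (hasDerivAt_angularDeriv ha hb hx)
  convert! h1.add h2 using 1
  simp [verticalPartDeriv]

lemma contDiffOn_radialPart (ha : 0 < a) (hb : 0 < b) (k : ℕ) :
    ContDiffOn ℝ k (radialPart a b) (Ioi (-1)) :=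
  (contDiffOn_const.mul (contDiffOn_angular ha hb k)).sub
    ((contDiffOn_id.mul (contDiffOn_angularDeriv ha hb k)).div_const 2)

lemma contDiffOn_verticalPart (ha : 0 < a) (hb : 0 < b) (k : ℕ) :
    ContDiffOn ℝ k (verticalPart a b) (Ioi (-1)) :=
  ((contDiffOn_const.mul contDiffOn_id).mul (contDiffOn_angular ha hb k)).add
    ((contDiffOn_const.sub (contDiffOn_id.pow 2)).mul (contDiffOn_angularDeriv ha hb k))

/-- The extremal, in a form that makes sense on the whole half-space. -/
def solution (H : EuclideanSpace ℝ (Fin n) → ℝ) (a b : ℝ) (p : EuclideanSpace ℝ (Fin n) × ℝ) : ℝ :=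
  polarProfile H ((a + b) / 2) (angular a b) p

lemma hasDerivAt_polarProfile {e t : ℝ} {f f' : ℝ → ℝ} {x : EuclideanSpace ℝ (Fin n)}
    (hR : 0 < polar H x ^ 2 + t ^ 2) (ht : 0 ≤ t)
    (hf : ∀ x, -1 < x → HasDerivAt f (f' x) x) :
    HasDerivAt (fun t => polarProfile H e f (x, t))
      (polarProfile H (e + 1 / 2) (fun x => -2 * e * x * f x + (1 - x ^ 2) * f' x) (x, t)) t := by
  have hx : 0 ≤ t / √(polar H x ^ 2 + t ^ 2) := by positivity
  exact hasDerivAt_homogeneousProfile_snd hR (hf _ (by linarith))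

namespace IsFinslerNorm

lemma solution_flux (hH : IsFinslerNorm H) (ha : 0 < a) (hb : 0 < b) {t : ℝ} (ht : 0 < t) :
    finslerFlux H (fun y => solution H a b (y, t)) = fun y =>
      (2 * polarProfile H ((a + b) / 2 + 1) (radialPart a b) (y, t)) • y :=
  funext fun y => hH.finslerFlux_polarProfile ht (fun _ hx => hasDerivAt_angular ha hb hx) y

lemma solution_deriv (ha : 0 < a) (hb : 0 < b) (x : EuclideanSpace ℝ (Fin n)) {t : ℝ}
    (ht : 0 < t) : deriv (fun s => solution H a b (x, s)) t =
      polarProfile H ((a + b) / 2 + 1 / 2) (verticalPart a b) (x, t) :=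
  (hasDerivAt_polarProfile (polar_sq_add_pos_of_pos ht) ht.le
    (fun _ hx => hasDerivAt_angular ha hb hx)).deriv

lemma contDiffOn_solution (hH : IsFinslerNorm H) (ha : 0 < a) (hb : 0 < b) :
    ContDiffOn ℝ 1 (solution H a b) {p | 0 ≤ p.2 ∧ p ≠ 0} := fun _ hp =>
  (contDiffAt_polarProfile (hH.polar_sq_add_pos hp.2) hp.1 (contDiffOn_angular ha hb 1)
    hH.contDiff_polar_sq.contDiffAt).contDiffWithinAt

lemma contDiffOn_solution_two (hH : IsFinslerNorm H) (hpd : HasPosDefHessian H) (ha : 0 < a)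
    (hb : 0 < b) : ContDiffOn ℝ 2 (solution H a b) {p | p.1 ≠ 0 ∧ 0 ≤ p.2} := fun _ hp =>
  (contDiffAt_polarProfile (hH.polar_sq_add_pos fun h => hp.1 (by rw [h]; rfl)) hp.2
    (contDiffOn_angular ha hb 2) (hH.contDiffAt_polar_sq_two hpd hp.1)).contDiffWithinAt

lemma contDiffOn_solution_flux (hH : IsFinslerNorm H) (ha : 0 < a) (hb : 0 < b) :
    ContDiffOn ℝ 1 (fun p : EuclideanSpace ℝ (Fin n) × ℝ =>
      finslerFlux H (fun y => solution H a b (y, p.2)) p.1) {p | 0 < p.2} := by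
  have h : ContDiffOn ℝ 1 (fun p : EuclideanSpace ℝ (Fin n) × ℝ =>
      (2 * polarProfile H ((a + b) / 2 + 1) (radialPart a b) p) • p.1) {p | 0 < p.2} := fun p hp =>
    ((contDiffAt_const.mul (contDiffAt_polarProfile (polar_sq_add_pos_of_pos hp) (le_of_lt hp)
      (contDiffOn_radialPart ha hb 1) hH.contDiff_polar_sq.contDiffAt)).smul
        contDiffAt_fst).contDiffWithinAt
  exact h.congr fun p hp => by rw [hH.solution_flux ha hb hp]

lemma contDiffOn_solution_deriv (hH : IsFinslerNorm H) (ha : 0 < a) (hb : 0 < b) :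
    ContDiffOn ℝ 1 (fun p : EuclideanSpace ℝ (Fin n) × ℝ =>
      deriv (fun s => solution H a b (p.1, s)) p.2) {p | 0 < p.2} := by
  have h : ContDiffOn ℝ 1 (polarProfile H ((a + b) / 2 + 1 / 2) (verticalPart a b))
      {p | 0 < p.2} := fun p hp =>
    (contDiffAt_polarProfile (polar_sq_add_pos_of_pos hp) (le_of_lt hp)
      (contDiffOn_verticalPart ha hb 1) hH.contDiff_polar_sq.contDiffAt).contDiffWithinAt
  exact h.congr fun p hp => solution_deriv ha hb p.1 hp

lemma laplacianPhi_solution (hH : IsFinslerNorm H) (ha : 0 < a) (hb : 0 < b)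
    (hn : (n : ℝ) = 2 * (a + b) + 1) (x : EuclideanSpace ℝ (Fin n)) {t : ℝ} (ht : 0 < t) :
    laplacianPhi H (solution H a b) x t +
      (a - b) ^ 2 * (solution H a b (x, t) / Phi0 H (x, t) ^ 2) = 0 := by
  have hR := polar_sq_add_pos_of_pos (H := H) (x := x) ht
  have hdd : deriv (deriv fun s => solution H a b (x, s)) t =
      polarProfile H ((a + b) / 2 + 1 / 2 + 1 / 2) (fun x => -2 * ((a + b) / 2 + 1 / 2) * x *
        verticalPart a b x + (1 - x ^ 2) * verticalPartDeriv a b x) (x, t) := by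
    have hev : deriv (fun s => solution H a b (x, s)) =ᶠ[𝓝 t]
        fun s => polarProfile H ((a + b) / 2 + 1 / 2) (verticalPart a b) (x, s) := by
      filter_upwards [Ioi_mem_nhds ht] with s hs
      exact solution_deriv ha hb x hs
    rw [hev.deriv_eq]
    exact (hasDerivAt_polarProfile hR ht.le (fun _ hx => hasDerivAt_verticalPart ha hb hx)).deriv
  rw [laplacianPhi, finslerLaplacian, hH.solution_flux ha hb ht, hdd,
    hH.divergence_polarProfile_smul ht (fun _ hx => hasDerivAt_radialPart ha hb hx), Phi0,
    Real.sq_sqrt hR.le]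
  set ρ := √(polar H x ^ 2 + t ^ 2) with hρdef
  have hρ : 0 < ρ := Real.sqrt_pos.2 hR
  have hsq : ρ ^ 2 = polar H x ^ 2 + t ^ 2 := Real.sq_sqrt hR.le
  have hX0 : 0 < t / ρ := by positivity
  have hX1 : t / ρ ≤ 1 := by
    rw [div_le_one hρ]
    exact Real.le_sqrt_of_sq_le (by linarith [sq_nonneg (polar H x)])
  have hode := angular_ode ha hb (show -1 < t / ρ by linarith) hX1
  -- With this substitution every term is `ρ ^ (-(a+b) - 2)` times a function of `X = t / ρ`, so
  -- what remains is the angular ODE.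
  have hQ : polar H x ^ 2 = ρ ^ 2 * (1 - (t / ρ) ^ 2) := by
    field_simp; linarith
  simp only [solution, polarProfile, homogeneousProfile, ← hρdef]
  have hpow : ∀ c : ℝ, (polar H x ^ 2 + t ^ 2) ^ (-(c + 1)) =
      (polar H x ^ 2 + t ^ 2) ^ (-c) * (polar H x ^ 2 + t ^ 2)⁻¹ := fun c => by
    rw [neg_add, Real.rpow_add hR, Real.rpow_neg_one]
  rw [show (a + b) / 2 + 1 / 2 + 1 / 2 = (a + b) / 2 + 1 by ring, hpow ((a + b) / 2 + 1),
    hpow ((a + b) / 2), ← hsq, hQ, hn]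
  generalize t / ρ = X at *
  generalize ((ρ ^ 2) ^ (-((a + b) / 2)) : ℝ) = Y
  simp only [radialPart, radialPartDeriv, verticalPart, verticalPartDeriv]
  generalize angular a b X = W at *
  generalize angularDeriv a b X = W' at *
  generalize angularDerivTwo a b X = W'' at *
  field_simp
  linear_combination 4 * Y * hode

lemma hasDerivWithinAt_solution (hH : IsFinslerNorm H) (ha : 0 < a) (hb : 0 < b)
    {x : EuclideanSpace ℝ (Fin n)} (hx : x ≠ 0) :
    HasDerivWithinAt (fun t => solution H a b (x, t))
      (angularCoeff a b 1 / Phi0 H (x, 0) ^ (a + b + 1)) (Ici 0) 0 := by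
  have hp := hH.polar_pos hx
  have h := hasDerivAt_polarProfile (e := (a + b) / 2) (H := H) (x := x) (t := 0)
    (by positivity) le_rfl (fun _ hx => hasDerivAt_angular ha hb hx)
  -- Since `angular` is smooth across 0, the derivative in `t` is two-sided and only then
  -- restricted.
  convert! h.hasDerivWithinAt using 1
  simp only [polarProfile, homogeneousProfile, Phi0, zero_div, angularDeriv_zero ha hb]
  have e1 : (polar H x ^ 2 + 0 ^ 2) = polar H x ^ 2 := by ring
  rw [e1, Real.sqrt_sq hp.le, ← Real.rpow_natCast, ← Real.rpow_mul hp.le,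
    show ((2 : ℕ) : ℝ) * -((a + b) / 2 + 1 / 2) = -(a + b + 1) by push_cast; ring,
    Real.rpow_neg hp.le]
  field_simp
  ring

lemma solution_zero (hH : IsFinslerNorm H) (ha : 0 < a) (hb : 0 < b)
    {x : EuclideanSpace ℝ (Fin n)} (hx : x ≠ 0) :
    solution H a b (x, 0) = Phi0 H (x, 0) ^ (-(a + b)) := by
  have hp := hH.polar_pos hx
  simp only [solution, polarProfile, homogeneousProfile, Phi0, zero_div, angular_zero ha hb]
  have e1 : (polar H x ^ 2 + 0 ^ 2) = polar H x ^ 2 := by ring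
  rw [e1, Real.sqrt_sq hp.le, ← Real.rpow_natCast, ← Real.rpow_mul hp.le, mul_one]
  congr 1
  push_cast; ring

lemma solution_eq_extremal (hH : IsFinslerNorm H) {N β : ℝ} (ha : 0 < (N + β) / 4 - 1)
    (hb : 0 < (N - β) / 4) {x : EuclideanSpace ℝ (Fin n)} (hx : x ≠ 0) {t : ℝ} (ht : 0 ≤ t) :
    solution H ((N + β) / 4 - 1) ((N - β) / 4) (x, t) = extremal N β H (x, t) := by
  have hp := hH.polar_pos hx
  have hR : 0 < polar H x ^ 2 + t ^ 2 := by positivity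
  -- Off the axis `t / ρ < 1` strictly, so the hypergeometric splitting applies.
  have hlt : t < √(polar H x ^ 2 + t ^ 2) := Real.lt_sqrt_of_sq_lt (by nlinarith)
  simp only [solution, polarProfile, homogeneousProfile, extremal, Phi0]
  have hsq := Real.sq_sqrt hR.le
  set ρ := √(polar H x ^ 2 + t ^ 2)
  have hρ : 0 < ρ := ht.trans_lt hlt
  have hX0 : 0 ≤ t / ρ := by positivity
  rw [angular_eq_profile ha hb (by rw [abs_of_nonneg hX0, div_lt_one hρ]; exact hlt), ← hsq,
    ← Real.rpow_natCast ρ 2, ← Real.rpow_mul hρ.le,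
    show ((2 : ℕ) : ℝ) * -(((N + β) / 4 - 1 + (N - β) / 4) / 2) = -((N - 2) / 2) by
      push_cast; ring, Real.rpow_neg hρ.le, show N / 2 = (N - 2) / 2 + 1 by ring,
    Real.rpow_add hρ, Real.rpow_one, Real.rpow_natCast, div_pow]
  have : 0 < ρ ^ ((N - 2) / 2) := Real.rpow_pos_of_pos hρ _
  field_simp

end IsFinslerNorm

end Solution

end

end FinslerKato

/-! ### Specialization of the parameters and assembly. -/

theorem proposition3p1 (N : ℕ) (hN : 3 ≤ N) (β : ℝ) (hβ : 2 ≤ β) (hβN : β < N)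
    (H : EuclideanSpace ℝ (Fin (N - 1)) → ℝ) (hH : FinslerKato.IsFinslerNorm H) :
    (∃ φ : EuclideanSpace ℝ (Fin (N - 1)) × ℝ → ℝ,
      (∀ x : EuclideanSpace ℝ (Fin (N - 1)), x ≠ 0 → ∀ t : ℝ, 0 ≤ t →
        φ (x, t) = FinslerKato.extremal N β H (x, t)) ∧
      FinslerKato.IsRegularSolution N β H φ ∧
      (FinslerKato.HasPosDefHessian H → ContDiffOn ℝ 2 φ {p | p.1 ≠ 0 ∧ 0 ≤ p.2}) ∧
      (∀ x : EuclideanSpace ℝ (Fin (N - 1)), x ≠ 0 →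
        HasDerivWithinAt (fun t => φ (x, t))
          (-(FinslerKato.K N β / FinslerKato.Phi0 H (x, 0) ^ ((N : ℝ) / 2))) (Set.Ici 0) 0)) ∧
    (∀ k : ℝ,
      ((∃ C : ℝ, ∀ θ ∈ Set.Ico 0 (Real.pi / 2),
          |FinslerKato.profile N β k (Real.sin θ ^ 2)| ≤ C) ↔ k = -FinslerKato.K N β) ∧
      ((∃ L : ℝ, Filter.Tendsto (fun θ => FinslerKato.profile N β k (Real.sin θ ^ 2))
          (nhdsWithin (Real.pi / 2) (Set.Iio (Real.pi / 2))) (nhds L)) ↔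
        k = -FinslerKato.K N β)) := by
  have hN' : (3 : ℝ) ≤ N := by exact_mod_cast hN
  have ha : 0 < ((N : ℝ) + β) / 4 - 1 := by linarith
  have hb : 0 < ((N : ℝ) - β) / 4 := by linarith
  have hn : ((N - 1 : ℕ) : ℝ) = 2 * (((N : ℝ) + β) / 4 - 1 + ((N : ℝ) - β) / 4) + 1 := by
    rw [Nat.cast_sub (by omega)]
    push_cast; ring
  refine ⟨⟨FinslerKato.solution H (((N : ℝ) + β) / 4 - 1) (((N : ℝ) - β) / 4),
    fun x hx t ht => hH.solution_eq_extremal ha hb hx ht,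
    ⟨hH.contDiffOn_solution ha hb, hH.contDiffOn_solution_flux ha hb,
      hH.contDiffOn_solution_deriv ha hb, fun x t ht => ?_, fun x hx => ?_⟩,
    fun hpd => hH.contDiffOn_solution_two hpd ha hb, fun x hx => ?_⟩,
    fun k => ⟨FinslerKato.profile_bounded_iff hN' ha hb k,
      FinslerKato.profile_tendsto_iff hN' ha hb k⟩⟩
  · have h := hH.laplacianPhi_solution ha hb hn x ht
    rw [← h]
    ring
  · rw [hH.solution_zero ha hb hx]
    congr 1
    ring
  · have h := hH.hasDerivWithinAt_solution ha hb hx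
    rw [FinslerKato.angularCoeff_one_eq_neg_K ha hb, neg_div,
      show ((N : ℝ) + β) / 4 - 1 + ((N : ℝ) - β) / 4 + 1 = N / 2 by ring] at h
    exact h
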